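/- For integers $r\ge 1$ and $1\le k\le r+1$ let $H_k^r$ denote the $r$-uniform hypergraph ($r$-graph) with $r+1$ vertices and $k$ edges (it is unique up to isomorphism). For an $r$-graph $H$ let $\mathrm{ex}(n,H)$ be the largest number of edges of an $r$-graph with $n$ vertices which has no subgraph isomorphic to $H$, and let $\pi(H)=\lim_{n\to\infty}\mathrm{ex}(n,H)/\binom{n}{r}$ be its Turán density. For $1\le t\le r$ let $\xi_{r,t}$ be the length of the shortest arc which contains at least $t$ out of $r$ independent random points uniformly distributed on the circle of unit circumference, and let $e_{r,t}=\mathbf{E}[\xi_{r,t}]$. Fix an integer $k\ge 3$ and put $$C_k=\big((k-2)!\big)^{\frac1{k-2}}\;\Gamma\!\Big(1+\frac1{k-2}\Big).$$ Then: 1. For every $r\ge k-1$ the limit defining $\pi(H_k^r)$ exists, the random variable $\xi_{r,k-1}$ is integrable, and $$\pi(H_k^r)\;\ge\; e_{r,k-1}.$$ 2. As $r\to\infty$, $$e_{r,k-1}=\big(C_k+o(1)\big)\,r^{-\left(1+\frac1{k-2}\right)}.$$ 3. Consequently, as $r\to\infty$, $$\pi(H_k^r)\;\ge\;\big(C_k-o(1)\big)\,r^{-\left(1+\frac1{k-2}\right)}.$$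 -/

import Mathlib

open Filter Topology MeasureTheory
open scoped Nat

/-- An `r`-uniform hypergraph (`r`-graph) with vertex set `V`: a finite set of edges, each of which
is an `r`-element set of vertices. -/
structure RGraph (r : ℕ) (V : Type*) where
  edges : Finset (Finset V)
  card_of_mem : ∀ e ∈ edges, e.card = r

namespace RGraph

/-- `G` has a subgraph isomorphic to `H`: an injection of the vertices of `H` into those of `G`
carries every edge of `H` to an edge of `G`. -/
def Contains {r : ℕ} {V W : Type*} (G : RGraph r V) (H : RGraph r W) : Prop :=
  ∃ f : W ↪ V, ∀ e ∈ H.edges, e.map f ∈ G.edges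

/-- The Turán number `ex(n, H)`: the largest number of edges of an `H`-free `r`-graph with `n`
vertices. (The set is bounded, and it is nonempty as soon as `H` has an edge.) -/
noncomputable def turanNumber {r : ℕ} {W : Type*} (n : ℕ) (H : RGraph r W) : ℕ :=
  sSup {m : ℕ | ∃ G : RGraph r (Fin n), ¬ G.Contains H ∧ G.edges.card = m}

/-- The Turán density `π(H)`: the limit of `ex(n, H) / (n choose r)` as `n → ∞`. -/
noncomputable def turanDensity {r : ℕ} {W : Type*} (H : RGraph r W) : ℝ :=
  limUnder atTop (fun n : ℕ => (turanNumber n H : ℝ) / (n.choose r : ℝ))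

/-- `H_k^r`: the `r`-graph with `r + 1` vertices `0, …, r` and the edges obtained by omitting
one of the vertices `0, …, k - 1`. For `k ≤ r + 1` it is, up to isomorphism, the only `r`-graph with
`r + 1` vertices and `k` edges. -/
def kEdge (r k : ℕ) : RGraph r (Fin (r + 1)) where
  edges := (Finset.univ.filter (fun i : Fin (r + 1) => i.val < k)).image
    (fun i => Finset.univ.erase i)
  card_of_mem := by
    intro e he
    obtain ⟨i, -, rfl⟩ := Finset.mem_image.mp he
    simp

/-- For `k ≤ r + 1` the `r`-graph `H_k^r` has exactly `k` edges. -/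
theorem card_kEdge {r k : ℕ} (h : k ≤ r + 1) : (kEdge r k).edges.card = k := by
  unfold kEdge
  rw [Finset.card_image_of_injOn]
  · rw [Fin.card_filter_val_lt]
    omega
  · intro i _ j _ hij
    by_contra hne
    have hj : j ∈ Finset.univ.erase i := Finset.mem_erase.mpr ⟨fun h => hne h.symm, Finset.mem_univ _⟩
    have hij' : Finset.univ.erase i = Finset.univ.erase j := hij
    rw [hij'] at hj
    exact Finset.notMem_erase _ _ hj

end RGraph

/-- The closed arc of length `L` on the circle of unit circumference which starts at `a` and goes in
the positive direction (the whole circle if `L ≥ 1`). -/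
def circleArc (a : UnitAddCircle) (L : ℝ) : Set UnitAddCircle :=
  (fun s : ℝ => a + (s : UnitAddCircle)) '' Set.Icc 0 L

/-- The length of the shortest arc of the circle of unit circumference which contains at least `t`
of the `r` points `x 0, …, x (r - 1)`. -/
noncomputable def shortestArc {r : ℕ} (t : ℕ) (x : Fin r → UnitAddCircle) : ℝ :=
  sInf {L : ℝ | 0 ≤ L ∧ ∃ a : UnitAddCircle, t ≤ {i : Fin r | x i ∈ circleArc a L}.ncard}

/-- `e_{r,t}`: the expected length of the shortest arc which contains at least `t` out of `r`
independent uniformly distributed random points of the circle of unit circumference. (`volume` on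
`Fin r → UnitAddCircle` is the product of the uniform probability measures.) -/
noncomputable def expectedShortestArc (r t : ℕ) : ℝ :=
  ∫ x : Fin r → UnitAddCircle, shortestArc t x

/-- The constant `C_k = ((k - 2)!)^{1/(k-2)} Γ(1 + 1/(k-2))`, for `k ≥ 3`. -/
noncomputable def arcConst (k : ℕ) : ℝ :=
  ((k - 2)! : ℝ) ^ (1 / ((k : ℝ) - 2)) * Real.Gamma (1 + 1 / ((k : ℝ) - 2))

/-! Lower bound. Place `n` vertices at points of the circle and take as edges the `r`-sets `e` for
which no arc of length `circRep (∑ v ∈ e, x v)` contains `k - 1` points of `e`. This graph is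
`H_k^r`-free for every placement (`RGraph.not_contains_circleGraph`). In a copy with points `y j`
and total `s`, let `i` maximise `circRep (s - y i)` among the `k` vertices that are omitted by
edges. For the other such `j`, `y j - y i = (s - y i) - (s - y j)` has representative at most
`circRep (s - y i)`, so the arc of that length from `y i` catches `k - 1` points of the edge
omitting `i`. For random points, a common rotation by `c` keeps the shortest arc and moves the sum
by `r • c`, which is uniform. So an `r`-set is an edge with probability equal to the mean shortest
arc (`volume_not_hasCluster_sum`). Some placement does at least as well as the average, and `n → ∞`
gives the density bound.

Asymptotics. Put `t = k - 1` and `s = k - 2`. With `β = 1 + 1/s`, the mean times `r ^ β` is the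
integral over `z > 0` of the probability that no arc of length `L = z * r ^ (-β)` holds `t` points.
Count the `t`-sets with a marked point from which an arc of length `L` covers the set: the mean
count is `t * r.choose t * L ^ s`, which tends to `z ^ s / s !`. The events are only locally
dependent, so a Chen–Stein estimate (`abs_real_forall_notMem_sub_exp_le`) gives the limit `exp (-z ^
s / s !)`, whose integral is a Gamma value equal to `C_k`. Dominated convergence applies because
cutting the points into independent blocks gives a stretched exponential tail
(`exists_noClusterProb_le_exp`). -/

instance : IsProbabilityMeasure (volume : Measure UnitAddCircle) :=
  ⟨UnitAddCircle.measure_univ⟩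

/-! ### Representatives of circle points in the unit interval. -/

/-- The representative in `[0, 1)` of a point of the circle. -/
noncomputable def circRep (y : UnitAddCircle) : ℝ := (AddCircle.equivIco 1 0 y : ℝ)

theorem circRep_nonneg (y : UnitAddCircle) : 0 ≤ circRep y := (AddCircle.equivIco 1 0 y).2.1

theorem circRep_lt_one (y : UnitAddCircle) : circRep y < 1 :=
  (AddCircle.equivIco (1 : ℝ) 0 y).2.2.trans_eq (zero_add 1)

theorem coe_circRep (y : UnitAddCircle) : ((circRep y : ℝ) : UnitAddCircle) = y :=
  AddCircle.coe_equivIco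

theorem circRep_coe (s : ℝ) : circRep (s : UnitAddCircle) = Int.fract s := by
  simp [circRep]

theorem circRep_coe_of_mem {s : ℝ} (h0 : 0 ≤ s) (h1 : s < 1) :
    circRep (s : UnitAddCircle) = s := by
  rw [circRep_coe, Int.fract_eq_self.2 ⟨h0, h1⟩]

theorem circRep_coe_le {s : ℝ} (h0 : 0 ≤ s) : circRep (s : UnitAddCircle) ≤ s := by
  rw [circRep_coe, Int.fract]
  have : (0 : ℝ) ≤ ⌊s⌋ := by exact_mod_cast Int.floor_nonneg.2 h0
  linarith

@[simp] theorem circRep_zero : circRep 0 = 0 := by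
  rw [← AddCircle.coe_zero, circRep_coe, Int.fract_zero]

theorem circRep_sub {p q : UnitAddCircle} (h : circRep q ≤ circRep p) :
    circRep (p - q) = circRep p - circRep q := by
  conv_lhs => rw [← coe_circRep p, ← coe_circRep q, ← AddCircle.coe_sub]
  apply circRep_coe_of_mem
  · linarith
  · linarith [circRep_lt_one p, circRep_nonneg q]

theorem mem_circleArc {a y : UnitAddCircle} {L : ℝ} :
    y ∈ circleArc a L ↔ circRep (y - a) ≤ L := by
  constructor
  · rintro ⟨s, ⟨h0, h1⟩, rfl⟩
    have : a + (s : UnitAddCircle) - a = s := by abel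
    simp only [this]
    exact (circRep_coe_le h0).trans h1
  · intro h
    refine ⟨circRep (y - a), ⟨circRep_nonneg _, h⟩, ?_⟩
    simp only [coe_circRep]
    abel

theorem measurable_circRep : Measurable circRep :=
  measurable_subtype_coe.comp (AddCircle.measurableEquivIco (1 : ℝ) 0).measurable

theorem volume_circRep_preimage {B : Set ℝ} (hB : MeasurableSet B) :
    volume (circRep ⁻¹' B) = volume (B ∩ Set.Ico 0 1) := by
  rw [AddCircle.add_projection_respects_measure (T := 1) 0 (measurable_circRep hB)]
  have h1 : (Set.Ioc (0 : ℝ) (0 + 1) : Set ℝ) =ᵐ[volume] Set.Ico (0 : ℝ) 1 := by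
    rw [zero_add]; exact Ico_ae_eq_Ioc.symm
  rw [measure_congr ((ae_eq_refl _).inter h1)]
  congr 1
  ext s
  simp only [Set.mem_inter_iff, Set.mem_preimage]
  refine and_congr_left fun hs => ?_
  have : circRep (QuotientAddGroup.mk s : UnitAddCircle) = s := circRep_coe_of_mem hs.1 hs.2
  rw [this]

theorem volume_circRep_le {L : ℝ} (h1 : L < 1) :
    volume {y : UnitAddCircle | circRep y ≤ L} = ENNReal.ofReal L := by
  have := volume_circRep_preimage (measurableSet_Iic (a := L))
  have h : Set.Iic L ∩ Set.Ico (0 : ℝ) 1 = Set.Icc 0 L := by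
    ext s; simp only [Set.mem_inter_iff, Set.mem_Iic, Set.mem_Ico, Set.mem_Icc]
    constructor
    · rintro ⟨a, b, c⟩; exact ⟨b, a⟩
    · rintro ⟨a, b⟩; exact ⟨b, a, by linarith⟩
  rw [h, Real.volume_Icc, sub_zero] at this
  exact this

theorem volume_circRep_lt {L : ℝ} (h1 : L ≤ 1) :
    volume {y : UnitAddCircle | circRep y < L} = ENNReal.ofReal L := by
  have := volume_circRep_preimage (measurableSet_Iio (a := L))
  have h : Set.Iio L ∩ Set.Ico (0 : ℝ) 1 = Set.Ico 0 L := by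
    ext s; simp only [Set.mem_inter_iff, Set.mem_Iio, Set.mem_Ico]
    constructor
    · rintro ⟨a, b, c⟩; exact ⟨b, a⟩
    · rintro ⟨a, b⟩; exact ⟨b, a, by linarith⟩
  rw [h, Real.volume_Ico, sub_zero] at this
  exact this

/-! ### Clusters of points in short arcs. -/

/-- Some closed arc of length `L` contains at least `t` of the points `x i`. -/
def HasCluster {ι : Type*} (t : ℕ) (x : ι → UnitAddCircle) (L : ℝ) : Prop :=
  ∃ a : UnitAddCircle, t ≤ {i : ι | x i ∈ circleArc a L}.ncard

theorem hasCluster_add_const {ι : Type*} {t : ℕ} {x : ι → UnitAddCircle} {L : ℝ}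
    (c : UnitAddCircle) :
    HasCluster t (fun i => x i + c) L ↔ HasCluster t x L := by
  constructor
  · rintro ⟨a, ha⟩
    refine ⟨a - c, ?_⟩
    simpa only [mem_circleArc, show ∀ i, x i + c - a = x i - (a - c) by intro i; abel] using ha
  · rintro ⟨a, ha⟩
    refine ⟨a + c, ?_⟩
    simpa only [mem_circleArc, add_sub_add_right_eq_sub] using ha

theorem measurable_circRep_sub {ι : Type*} (i j : ι) :
    Measurable fun x : ι → UnitAddCircle => circRep (x j - x i) :=
  measurable_circRep.comp ((measurable_pi_apply j).sub (measurable_pi_apply i))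

section Cluster

variable {ι : Type*} [Finite ι] {t : ℕ} {x : ι → UnitAddCircle} {L L' : ℝ}

theorem hasCluster_of_finset {a : UnitAddCircle} {T : Finset ι} (hT : T.card = t)
    (h : ∀ j ∈ T, circRep (x j - a) ≤ L) : HasCluster t x L := by
  refine ⟨a, ?_⟩
  rw [← hT, ← Set.ncard_coe_finset]
  exact Set.ncard_le_ncard (fun j hj => mem_circleArc.2 (h j hj)) (Set.toFinite _)

/-- An arc can be shortened to start at the first of the chosen points it contains. This replaces
the free starting point by a finite choice, from which measurability and closedness follow. -/
theorem hasCluster_iff (ht : 0 < t) :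
    HasCluster t x L ↔
      ∃ T : Finset ι, T.card = t ∧ ∃ i ∈ T, ∀ j ∈ T, circRep (x j - x i) ≤ L := by
  constructor
  · rintro ⟨a, ha⟩
    obtain ⟨T₀, hT₀, hc⟩ := Set.exists_subset_card_eq ha
    obtain ⟨T, rfl⟩ := (Set.toFinite T₀).exists_finset_coe
    rw [Set.ncard_coe_finset] at hc
    have hne : T.Nonempty := Finset.card_pos.1 (hc ▸ ht)
    obtain ⟨i, hi, hmin⟩ := T.exists_min_image (fun i => circRep (x i - a)) hne
    refine ⟨T, hc, i, hi, fun j hj => ?_⟩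
    have h := circRep_sub (hmin j hj)
    rw [sub_sub_sub_cancel_right] at h
    have := mem_circleArc.1 (hT₀ hj)
    rw [h]
    linarith [circRep_nonneg (x i - a)]
  · rintro ⟨T, hT, i, -, h⟩
    exact hasCluster_of_finset hT h

theorem HasCluster.mono (h : HasCluster t x L) (hL : L ≤ L') : HasCluster t x L' := by
  obtain ⟨a, ha⟩ := h
  exact ⟨a, ha.trans (Set.ncard_le_ncard
    (fun j hj => mem_circleArc.2 ((mem_circleArc.1 hj).trans hL)) (Set.toFinite _))⟩

theorem HasCluster.nonneg (ht : 0 < t) (h : HasCluster t x L) : 0 ≤ L := by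
  obtain ⟨T, -, i, hi, h⟩ := (hasCluster_iff ht).1 h
  exact (circRep_nonneg _).trans (h i hi)

theorem HasCluster.of_comp {κ : Type*} {g : κ → ι} (hg : Function.Injective g)
    (h : HasCluster t (x ∘ g) L) : HasCluster t x L := by
  obtain ⟨a, ha⟩ := h
  refine ⟨a, ha.trans ?_⟩
  rw [← Set.ncard_image_of_injective _ hg]
  apply Set.ncard_le_ncard _ (Set.toFinite _)
  rintro _ ⟨j, hj, rfl⟩
  exact hj

theorem measurableSet_hasCluster (ht : 0 < t) {f : (ι → UnitAddCircle) → ℝ} (hf : Measurable f) :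
    MeasurableSet {x : ι → UnitAddCircle | HasCluster t x (f x)} := by
  have := Fintype.ofFinite ι
  have : {x : ι → UnitAddCircle | HasCluster t x (f x)} =
      ⋃ T : Finset ι, ⋃ (_ : T.card = t), ⋃ i ∈ T, ⋂ j ∈ T,
        {x | circRep (x j - x i) ≤ f x} := by
    ext x; simp only [Set.mem_ofPred_eq, hasCluster_iff ht, Set.mem_iUnion, Set.mem_iInter,
      exists_prop]
  rw [this]
  refine MeasurableSet.iUnion fun T => MeasurableSet.iUnion fun _ =>
    MeasurableSet.biUnion T.countable_toSet fun i _ =>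
    MeasurableSet.biInter T.countable_toSet fun j _ => ?_
  exact measurableSet_le (measurable_circRep_sub i j) hf

theorem isClosed_setOf_hasCluster (ht : 0 < t) : IsClosed {L | HasCluster t x L} := by
  have := Fintype.ofFinite ι
  have : {L | HasCluster t x L} =
      ⋃ T : Finset ι, ⋃ (_ : T.card = t), ⋃ i ∈ (T : Set ι), ⋂ j ∈ T,
        Set.Ici (circRep (x j - x i)) := by
    ext x; simp only [Set.mem_ofPred_eq, hasCluster_iff ht, Set.mem_iUnion, Set.mem_iInter,
      exists_prop, Set.mem_Ici, Finset.mem_coe]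
  rw [this]
  refine isClosed_iUnion_of_finite fun T => isClosed_iUnion_of_finite fun _ =>
    T.finite_toSet.isClosed_biUnion fun i _ => isClosed_biInter fun j _ => isClosed_Ici

end Cluster

/-! ### The shortest arc as a random variable. -/

section ShortestArc

variable {r t : ℕ} (x : Fin r → UnitAddCircle)

theorem hasCluster_one (htr : t ≤ r) : HasCluster t x 1 := by
  obtain ⟨T, -, hT⟩ := Finset.exists_subset_card_eq
    (show t ≤ (Finset.univ : Finset (Fin r)).card by simpa using htr)
  exact hasCluster_of_finset (a := 0) hT fun j _ => (circRep_lt_one _).le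

theorem shortestArc_nonneg : 0 ≤ shortestArc t x := Real.sInf_nonneg fun _ h => h.1

theorem shortestArc_le_one (htr : t ≤ r) : shortestArc t x ≤ 1 :=
  csInf_le ⟨0, fun _ h => h.1⟩ ⟨zero_le_one, hasCluster_one x htr⟩

/-- The admissible lengths form a closed, upward closed set, so the infimum is attained. -/
theorem hasCluster_iff_shortestArc_le (ht : 0 < t) (htr : t ≤ r) (L : ℝ) :
    HasCluster t x L ↔ shortestArc t x ≤ L := by
  have hset : {L : ℝ | 0 ≤ L ∧ ∃ a : UnitAddCircle, t ≤ {i : Fin r | x i ∈ circleArc a L}.ncard}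
      = {L | HasCluster t x L} := by
    ext L
    exact ⟨fun h => h.2, fun h => ⟨HasCluster.nonneg ht h, h⟩⟩
  have hbdd : BddBelow {L | HasCluster t x L} := ⟨0, fun _ h => HasCluster.nonneg ht h⟩
  unfold shortestArc
  rw [hset]
  constructor
  · exact fun h => csInf_le hbdd h
  · intro h
    exact HasCluster.mono ((isClosed_setOf_hasCluster ht).csInf_mem
      ⟨1, hasCluster_one x htr⟩ hbdd) h

theorem measurable_shortestArc (ht : 0 < t) (htr : t ≤ r) :
    Measurable fun x : Fin r → UnitAddCircle => shortestArc t x := by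
  refine measurable_of_Iic fun L => ?_
  simp only [Set.preimage, Set.mem_Iic, ← hasCluster_iff_shortestArc_le _ ht htr]
  exact measurableSet_hasCluster ht measurable_const

theorem integrable_shortestArc (ht : 0 < t) (htr : t ≤ r) :
    Integrable fun x : Fin r → UnitAddCircle => shortestArc t x := by
  refine Integrable.of_bound (measurable_shortestArc ht htr).aestronglyMeasurable 1
    (ae_of_all _ fun x => ?_)
  rw [Real.norm_of_nonneg (shortestArc_nonneg x)]
  exact shortestArc_le_one x htr

end ShortestArc

/-! ### Measure-preserving maps of the torus. -/

/-- A continuous surjective homomorphism pushes Haar measure to Haar measure, and equal total mass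
fixes the scale. This replaces Fubini arguments for selecting, splitting and shearing coordinates.
-/
theorem measurePreserving_addMonoidHom_pi {ι G : Type*} [Fintype ι] [AddCommGroup G]
    [TopologicalSpace G] [IsTopologicalAddGroup G] [CompactSpace G] [MeasurableSpace G]
    [BorelSpace G] {ν : Measure G} [ν.IsAddHaarMeasure] [IsProbabilityMeasure ν]
    (f : (ι → UnitAddCircle) →+ G) (hf : Continuous f) (hs : Function.Surjective f) :
    MeasurePreserving f volume ν :=
  f.measurePreserving hf hs (by rw [measure_univ, measure_univ])

/-- Selecting coordinates preserves the uniform measure. -/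
theorem measurePreserving_comp_injective {ι κ : Type*} [Fintype ι] [Fintype κ] {g : κ → ι}
    (hg : Function.Injective g) :
    MeasurePreserving (fun x : ι → UnitAddCircle => x ∘ g) volume volume :=
  measurePreserving_addMonoidHom_pi
    (f := { toFun := fun x : ι → UnitAddCircle => x ∘ g
            map_zero' := rfl
            map_add' := fun _ _ => rfl })
    (continuous_pi fun k => continuous_apply (g k)) hg.surjective_comp_right

/-- Passing to the differences with a fixed coordinate preserves the uniform measure. -/
theorem measurePreserving_sub_coord {ι : Type*} [Fintype ι] [DecidableEq ι] (i : ι) :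
    MeasurePreserving
      (fun (x : ι → UnitAddCircle) j => if j = i then x i else x j - x i) volume volume :=
  measurePreserving_addMonoidHom_pi
    (f := { toFun := fun x j => if j = i then x i else x j - x i
            map_zero' := by ext j; simp
            map_add' := fun x y => by
              ext j
              by_cases h : j = i
              · simp [h]
              · simp only [h, if_false, Pi.add_apply]; abel })
    (continuous_pi fun j => by
      by_cases h : j = i
      · simpa [h] using continuous_apply i
      · simp only [AddMonoidHom.coe_mk, ZeroHom.coe_mk, h, if_false]
        exact (continuous_apply j).sub (continuous_apply i))
    (fun y => ⟨fun j => if j = i then y i else y j + y i, by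
      ext j
      by_cases h : j = i
      · simp [h]
      · simp [h]⟩)

/-- For `m` points other than `x i`, the probability that all their differences with `x i` lie in
`B` is `|B| ^ m`. -/
theorem volume_forall_sub_mem {ι : Type*} [Fintype ι] [DecidableEq ι] {i : ι} {S : Finset ι}
    (hi : i ∉ S) {B : Set UnitAddCircle} (hB : MeasurableSet B) :
    volume {x : ι → UnitAddCircle | ∀ j ∈ S, x j - x i ∈ B} = volume B ^ S.card := by
  have hm : MeasurableSet (Set.univ.pi fun j => if j ∈ S then B else Set.univ) :=
    MeasurableSet.univ_pi fun j => by split_ifs <;> simp [hB]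
  have h := (measurePreserving_sub_coord i).measure_preimage hm.nullMeasurableSet
  rw [volume_pi_pi] at h
  have h2 : ∏ j, volume (if j ∈ S then B else Set.univ) = volume B ^ S.card := by
    rw [← Finset.prod_const, ← Finset.prod_filter_mul_prod_filter_not Finset.univ (· ∈ S)]
    rw [Finset.prod_congr (g := fun _ => volume B) rfl
        (fun j hj => by rw [if_pos (Finset.mem_filter.1 hj).2]),
      Finset.prod_congr (s₁ := {j | j ∉ S}) (g := fun _ => 1) rfl
        (fun j hj => by rw [if_neg (Finset.mem_filter.1 hj).2, measure_univ])]
    simp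
  rw [h2] at h
  rw [← h]
  congr 1
  ext x
  simp only [Set.mem_ofPred_eq, Set.mem_preimage, Set.mem_univ_pi]
  refine forall_congr' fun j => ?_
  by_cases hj : j ∈ S
  · have : j ≠ i := fun h => hi (h ▸ hj)
    simp [hj, this]
  · simp [hj]

theorem real_volume_forall_circRep_sub_le {ι : Type*} [Fintype ι] [DecidableEq ι] {i : ι}
    {T : Finset ι} (hi : i ∈ T) {L : ℝ} (h0 : 0 ≤ L) (h1 : L < 1) :
    volume.real {x : ι → UnitAddCircle | ∀ j ∈ T, circRep (x j - x i) ≤ L} =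
      L ^ (T.card - 1) := by
  have h := volume_forall_sub_mem (Finset.notMem_erase i T)
    (B := {y | circRep y ≤ L}) (measurable_circRep measurableSet_Iic)
  rw [volume_circRep_le h1, Finset.card_erase_of_mem hi] at h
  have h2 : {x : ι → UnitAddCircle | ∀ j ∈ T, circRep (x j - x i) ≤ L} =
      {x | ∀ j ∈ T.erase i, x j - x i ∈ {y | circRep y ≤ L}} := by
    ext x
    simp only [Set.mem_ofPred_eq, Finset.mem_erase]
    refine ⟨fun h j hj => h j hj.2, fun h j hj => ?_⟩
    by_cases hji : j = i
    · simpa [hji] using h0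
    · exact h j ⟨hji, hj⟩
  rw [Measure.real, h2, h, ENNReal.toReal_pow, ENNReal.toReal_ofReal h0]

/-! ### Turán numbers and existence of the Turán density. -/

namespace RGraph

variable {r : ℕ} {V W : Type*}

theorem card_edges_le [Fintype V] (G : RGraph r V) :
    G.edges.card ≤ (Fintype.card V).choose r := by
  rw [← Finset.card_univ, ← Finset.card_powersetCard]
  exact Finset.card_le_card fun e he =>
    Finset.mem_powersetCard.2 ⟨e.subset_univ, G.card_of_mem e he⟩

theorem bddAbove_turan (n : ℕ) (H : RGraph r W) :
    BddAbove {m : ℕ | ∃ G : RGraph r (Fin n), ¬ G.Contains H ∧ G.edges.card = m} := by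
  refine ⟨n.choose r, ?_⟩
  rintro m ⟨G, -, rfl⟩
  simpa using G.card_edges_le

theorem card_edges_le_turanNumber {n : ℕ} {H : RGraph r W} {G : RGraph r (Fin n)}
    (h : ¬ G.Contains H) : G.edges.card ≤ turanNumber n H :=
  le_csSup (bddAbove_turan n H) ⟨G, h, rfl⟩

theorem exists_card_edges_eq_turanNumber (n : ℕ) {H : RGraph r W} (hH : H.edges.Nonempty) :
    ∃ G : RGraph r (Fin n), ¬ G.Contains H ∧ G.edges.card = turanNumber n H := by
  refine Nat.sSup_mem ?_ (bddAbove_turan n H)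
  refine ⟨0, ⟨∅, by simp⟩, ?_, rfl⟩
  rintro ⟨f, hf⟩
  obtain ⟨e, he⟩ := hH
  simpa using hf e he

/-- The subgraph of `G` induced on the vertices other than `v`. -/
noncomputable def deleteVertex {n : ℕ} (G : RGraph r (Fin (n + 1))) (v : Fin (n + 1)) :
    RGraph r (Fin n) where
  edges := Finset.univ.filter fun e => e.map (Fin.succAboveEmb v) ∈ G.edges
  card_of_mem e he := by
    rw [← G.card_of_mem _ (Finset.mem_filter.1 he).2, Finset.card_map]

theorem Contains.of_deleteVertex {n : ℕ} {G : RGraph r (Fin (n + 1))} {v : Fin (n + 1)}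
    {H : RGraph r W} (h : (G.deleteVertex v).Contains H) : G.Contains H := by
  obtain ⟨f, hf⟩ := h
  refine ⟨f.trans (Fin.succAboveEmb v), fun e he => ?_⟩
  rw [← Finset.map_map]
  exact (Finset.mem_filter.1 (hf e he)).2

theorem card_filter_notMem_le_card_deleteVertex {n : ℕ} (G : RGraph r (Fin (n + 1)))
    (v : Fin (n + 1)) :
    (G.edges.filter fun e => v ∉ e).card ≤ (G.deleteVertex v).edges.card := by
  rw [← Finset.card_map (Finset.mapEmbedding (Fin.succAboveEmb v)).toEmbedding]
  refine Finset.card_le_card fun e he => ?_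
  rw [Finset.mem_filter] at he
  have hmap : (Finset.univ.filter fun w => v.succAbove w ∈ e).map (Fin.succAboveEmb v) = e := by
    ext w
    simp only [Finset.mem_map, Finset.mem_filter, Finset.mem_univ, true_and, Fin.coe_succAboveEmb]
    constructor
    · rintro ⟨u, hu, rfl⟩; exact hu
    · intro hw
      obtain ⟨u, rfl⟩ := Fin.exists_succAbove_eq (x := w) (y := v) (fun h => he.2 (h ▸ hw))
      exact ⟨u, hw, rfl⟩
  refine Finset.mem_map.2 ⟨_, ?_, hmap⟩
  simp only [deleteVertex, Finset.mem_filter, Finset.mem_univ, true_and]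
  rw [hmap]
  exact he.1

/-- Double counting of pairs of an edge of an extremal graph and a vertex outside it; deleting the
vertex leaves an `H`-free graph. -/
theorem turanNumber_succ_mul_le (n : ℕ) {H : RGraph r W} (hH : H.edges.Nonempty) :
    turanNumber (n + 1) H * (n + 1 - r) ≤ turanNumber n H * (n + 1) := by
  obtain ⟨G, hG, hc⟩ := exists_card_edges_eq_turanNumber (n + 1) hH
  calc turanNumber (n + 1) H * (n + 1 - r)
      = ∑ e ∈ G.edges, (Finset.univ.filter fun v => v ∉ e).card := by
        rw [← hc, ← smul_eq_mul, ← Finset.sum_const]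
        refine Finset.sum_congr rfl fun e he => ?_
        have : (Finset.univ.filter fun v => v ∉ e) = eᶜ := by ext; simp
        rw [this, Finset.card_compl, G.card_of_mem e he, Fintype.card_fin]
    _ = ∑ v, (G.edges.filter fun e => v ∉ e).card := by
        simp only [Finset.card_filter]
        exact Finset.sum_comm
    _ ≤ ∑ _v : Fin (n + 1), turanNumber n H := by
        refine Finset.sum_le_sum fun v _ => ?_
        exact (G.card_filter_notMem_le_card_deleteVertex v).trans
          (card_edges_le_turanNumber fun h => hG h.of_deleteVertex)
    _ = turanNumber n H * (n + 1) := by simp [mul_comm]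

theorem tendsto_turanDensity {H : RGraph r W} (hH : H.edges.Nonempty) :
    Tendsto (fun n : ℕ => (turanNumber n H : ℝ) / (n.choose r : ℝ)) atTop
      (𝓝 (turanDensity H)) := by
  suffices h : ∃ l : ℝ,
      Tendsto (fun n : ℕ => (turanNumber n H : ℝ) / (n.choose r : ℝ)) atTop (𝓝 l) by
    exact tendsto_nhds_limUnder h
  -- The shift by `r` skips the indices at which the binomial coefficient vanishes.
  have hanti : Antitone fun n : ℕ => (turanNumber (n + r) H : ℝ) / ((n + r).choose r : ℝ) := by
    refine antitone_nat_of_succ_le fun n => ?_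
    have h1 := turanNumber_succ_mul_le (n + r) hH
    have h2 := Nat.choose_mul_succ_eq (n + r) r
    have hsub : n + r + 1 - r = n + 1 := by omega
    rw [hsub] at h1 h2
    have hp : 0 < (n + r).choose r := Nat.choose_pos (by omega)
    have hp' : 0 < (n + r + 1).choose r := Nat.choose_pos (by omega)
    rw [show n + 1 + r = n + r + 1 by omega]
    rw [div_le_div_iff₀ (by exact_mod_cast hp') (by exact_mod_cast hp)]
    have h3 : turanNumber (n + r + 1) H * (n + r).choose r * (n + 1) ≤
        turanNumber (n + r) H * (n + r + 1).choose r * (n + 1) := by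
      calc _ = turanNumber (n + r + 1) H * (n + 1) * (n + r).choose r := by ring
        _ ≤ turanNumber (n + r) H * (n + r + 1) * (n + r).choose r := by gcongr
        _ = turanNumber (n + r) H * ((n + r).choose r * (n + r + 1)) := by ring
        _ = _ := by rw [h2]; ring
    exact_mod_cast Nat.le_of_mul_le_mul_right h3 n.succ_pos
  have hbdd : BddBelow (Set.range fun n : ℕ =>
      (turanNumber (n + r) H : ℝ) / ((n + r).choose r : ℝ)) := by
    refine ⟨0, ?_⟩
    rintro _ ⟨n, rfl⟩
    positivity
  exact ⟨_, (tendsto_add_atTop_iff_nat r).1 (tendsto_atTop_ciInf hanti hbdd)⟩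

/-! ### The circle construction and its edge density. -/

/-- The `r`-graph on `n` points of the circle whose edges are the `r`-sets `e` such that no arc of
length `circRep (∑ v ∈ e, x v)` contains `t` of the points of `e`. -/
noncomputable def circleGraph (r t : ℕ) {n : ℕ} (x : Fin n → UnitAddCircle) :
    RGraph r (Fin n) :=
  open Classical in
  { edges := Finset.univ.filter fun e => ∃ h : e.card = r,
      ¬ HasCluster t (x ∘ e.orderEmbOfFin h) (circRep (∑ v ∈ e, x v))
    card_of_mem := fun _ he => (Finset.mem_filter.1 he).2.1 }

theorem mem_edges_circleGraph {r t n : ℕ} {x : Fin n → UnitAddCircle} {e : Finset (Fin n)} :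
    e ∈ (circleGraph r t x).edges ↔ ∃ h : e.card = r,
      ¬ HasCluster t (x ∘ e.orderEmbOfFin h) (circRep (∑ v ∈ e, x v)) := by
  simp [circleGraph]

theorem not_contains_circleGraph {r k n : ℕ} (hk : 1 ≤ k) (hkr : k ≤ r + 1)
    (x : Fin n → UnitAddCircle) : ¬ (circleGraph r (k - 1) x).Contains (kEdge r k) := by
  rintro ⟨f, hf⟩
  let K : Finset (Fin (r + 1)) := Finset.univ.filter fun i => i.val < k
  have hK : K.card = k := by
    simp only [K]
    rw [Fin.card_filter_val_lt]
    omega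
  set y : Fin (r + 1) → UnitAddCircle := x ∘ f
  set s : UnitAddCircle := ∑ i, y i
  obtain ⟨i, hi, hmax⟩ := K.exists_max_image (fun i => circRep (s - y i))
    (Finset.card_pos.1 (by omega))
  have hmem : (Finset.univ.erase i).map f ∈ (circleGraph r (k - 1) x).edges :=
    hf _ (Finset.mem_image_of_mem _ hi)
  obtain ⟨hc, hcl⟩ := mem_edges_circleGraph.1 hmem
  apply hcl
  have hsum : ∑ v ∈ (Finset.univ.erase i).map f, x v = s - y i := by
    rw [Finset.sum_map, eq_sub_iff_add_eq]
    exact Finset.sum_erase_add _ y (Finset.mem_univ i)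
  rw [hsum]
  set e := (Finset.univ.erase i).map f
  let T : Finset (Fin r) := Finset.univ.filter fun j => e.orderEmbOfFin hc j ∈ (K.erase i).map f
  have hT : T.map (e.orderEmbOfFin hc).toEmbedding = (K.erase i).map f := by
    ext v
    simp only [Finset.mem_map, T, Finset.mem_filter, Finset.mem_univ, true_and,
      RelEmbedding.coe_toEmbedding]
    constructor
    · rintro ⟨j, hj, rfl⟩; exact hj
    · rintro ⟨j, hj, rfl⟩
      have : f j ∈ Set.range (e.orderEmbOfFin hc) := by
        rw [Finset.range_orderEmbOfFin]
        simp only [e, Finset.coe_map]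
        exact ⟨j, by simpa using (Finset.mem_erase.1 hj).1, rfl⟩
      obtain ⟨u, hu⟩ := this
      exact ⟨u, ⟨j, hj, hu.symm⟩, hu⟩
  -- The arc starts at the omitted vertex, which is not a point of the edge; clusters allow any
  -- starting point.
  refine hasCluster_of_finset (a := y i) (T := T) ?_ fun u hu => ?_
  · rw [← Finset.card_map, hT, Finset.card_map, Finset.card_erase_of_mem hi, hK]
  · obtain ⟨j, hj, hju⟩ := Finset.mem_map.1 (Finset.mem_filter.1 hu).2
    have h := circRep_sub (hmax j (Finset.mem_of_mem_erase hj))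
    rw [sub_sub_sub_cancel_left] at h
    simp only [Function.comp_apply]
    rw [← hju]
    change circRep (y j - y i) ≤ _
    rw [h]
    linarith [circRep_nonneg (s - y j)]

end RGraph

/-- A uniformly random rotation makes the sum of the points uniform and independent of their mutual
position. -/
theorem volume_not_hasCluster_sum {r t : ℕ} (ht : 0 < t) (htr : t ≤ r) :
    volume.real {x : Fin r → UnitAddCircle | ¬ HasCluster t x (circRep (∑ i, x i))} =
      expectedShortestArc r t := by
  have hr : r ≠ 0 := by omega
  let f : (Fin r → UnitAddCircle) → ENNReal :=
    Set.indicator {x | ¬ HasCluster t x (circRep (∑ i, x i))} 1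
  have hA : MeasurableSet {x : Fin r → UnitAddCircle | ¬ HasCluster t x (circRep (∑ i, x i))} :=
    (measurableSet_hasCluster ht (measurable_circRep.comp (by fun_prop))).compl
  have hf : Measurable f := measurable_one.indicator hA
  have hshift : ∀ x : Fin r → UnitAddCircle,
      ∫⁻ c : UnitAddCircle, f (fun i => x i + c) = ENNReal.ofReal (shortestArc t x) := by
    intro x
    -- The sum of the rotated points is uniform in `c`, because multiplication by `r ≠ 0` preserves
    -- the measure of the circle.
    have hmp : MeasurePreserving (fun c : UnitAddCircle => ∑ i, x i + (r : ℤ) • c) volume volume :=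
      (measurePreserving_add_left volume (∑ i, x i)).comp
        (Measure.measurePreserving_zsmul volume (by exact_mod_cast hr))
    have hfc : ∀ c : UnitAddCircle, f (fun i => x i + c) =
        ((fun c : UnitAddCircle => ∑ i, x i + (r : ℤ) • c) ⁻¹'
          {y | circRep y < shortestArc t x}).indicator 1 c := by
      intro c
      refine Set.indicator_eq_indicator ?_ rfl
      simp only [Set.mem_ofPred_eq, Set.mem_preimage,
        hasCluster_add_const, hasCluster_iff_shortestArc_le x ht htr, not_le,
        Finset.sum_add_distrib, Finset.sum_const, Finset.card_univ, Fintype.card_fin,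
        natCast_zsmul]
    have hm : MeasurableSet {y | circRep y < shortestArc t x} := measurable_circRep measurableSet_Iio
    simp only [hfc]
    rw [lintegral_indicator_one (hmp.measurable hm), hmp.measure_preimage hm.nullMeasurableSet,
      volume_circRep_lt (shortestArc_le_one x htr)]
  have hinv : ∀ c : UnitAddCircle,
      ∫⁻ x : Fin r → UnitAddCircle, f (fun i => x i + c) = ∫⁻ x, f x := fun c =>
    lintegral_add_right_eq_self f (fun _ => c)
  have hswap : ∫⁻ x : Fin r → UnitAddCircle, f x =
      ∫⁻ x : Fin r → UnitAddCircle, ENNReal.ofReal (shortestArc t x) := by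
    calc ∫⁻ x, f x = ∫⁻ _c : UnitAddCircle, ∫⁻ x, f x := by simp
      _ = ∫⁻ c : UnitAddCircle, ∫⁻ x : Fin r → UnitAddCircle, f (fun i => x i + c) := by
          simp only [hinv]
      _ = ∫⁻ x : Fin r → UnitAddCircle, ∫⁻ c : UnitAddCircle, f (fun i => x i + c) :=
          lintegral_lintegral_swap (hf.comp (by fun_prop)).aemeasurable
      _ = _ := by simp only [hshift]
  rw [lintegral_indicator_one hA] at hswap
  rw [Measure.real, hswap, expectedShortestArc,
    integral_eq_lintegral_of_nonneg_ae (ae_of_all _ shortestArc_nonneg)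
      (measurable_shortestArc ht htr).aestronglyMeasurable]

theorem choose_mul_expectedShortestArc_le_turanNumber {r k : ℕ} (hk : 2 ≤ k) (hkr : k ≤ r + 1)
    (n : ℕ) :
    (n.choose r : ℝ) * expectedShortestArc r (k - 1) ≤
      RGraph.turanNumber n (RGraph.kEdge r k) := by
  have ht : 0 < k - 1 := by omega
  have htr : k - 1 ≤ r := by omega
  let E : Finset (Fin n) → Set (Fin n → UnitAddCircle) := fun e =>
    {x | e ∈ (RGraph.circleGraph r (k - 1) x).edges}
  have hEe : ∀ e : Finset (Fin n), ∀ h : e.card = r, E e =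
      (fun x => x ∘ e.orderEmbOfFin h) ⁻¹'
        {y | ¬ HasCluster (k - 1) y (circRep (∑ i, y i))} := by
    intro e h
    ext x
    simp only [E, RGraph.mem_edges_circleGraph, Set.mem_ofPred_eq, Set.mem_preimage]
    have hs : ∑ v ∈ e, x v = ∑ i, (x ∘ e.orderEmbOfFin h) i := by
      conv_lhs => rw [← Finset.map_orderEmbOfFin_univ e h, Finset.sum_map]
      rfl
    rw [hs]
    exact ⟨fun ⟨_, h⟩ => h, fun h' => ⟨h, h'⟩⟩
  have hA : MeasurableSet {y : Fin r → UnitAddCircle |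
      ¬ HasCluster (k - 1) y (circRep (∑ i, y i))} :=
    (measurableSet_hasCluster ht (measurable_circRep.comp (by fun_prop))).compl
  have hmp : ∀ e : Finset (Fin n), ∀ h : e.card = r, MeasurePreserving
      (fun x : Fin n → UnitAddCircle => x ∘ e.orderEmbOfFin h) volume volume := fun e h =>
    measurePreserving_comp_injective (e.orderEmbOfFin h).injective
  have hEm : ∀ e ∈ Finset.univ.powersetCard r, MeasurableSet (E e) := fun e he => by
    have h := (Finset.mem_powersetCard.1 he).2
    rw [hEe e h]
    exact (hmp e h).measurable hA
  have hint : ∀ e ∈ Finset.univ.powersetCard r,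
      Integrable ((E e).indicator (1 : (Fin n → UnitAddCircle) → ℝ)) := fun e he =>
    (integrable_const (1 : ℝ)).indicator (hEm e he)
  -- First moment method: some placement has at least the mean number of edges.
  obtain ⟨x, hx⟩ := exists_integral_le (integrable_finsetSum _ hint)
  rw [integral_finsetSum _ hint] at hx
  have hval : ∀ e ∈ (Finset.univ : Finset (Fin n)).powersetCard r,
      ∫ x, (E e).indicator (1 : (Fin n → UnitAddCircle) → ℝ) x =
        expectedShortestArc r (k - 1) := fun e he => by
    have h := (Finset.mem_powersetCard.1 he).2
    rw [integral_indicator_one (hEm e he), hEe e h, Measure.real,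
      (hmp e h).measure_preimage hA.nullMeasurableSet, ← Measure.real,
      volume_not_hasCluster_sum ht htr]
  rw [Finset.sum_congr rfl hval, Finset.sum_const, Finset.card_powersetCard, Finset.card_univ,
    Fintype.card_fin, nsmul_eq_mul] at hx
  refine hx.trans ?_
  refine le_trans ?_ (Nat.cast_le.2 (RGraph.card_edges_le_turanNumber
    (RGraph.not_contains_circleGraph (by omega) hkr x)))
  classical
  have hsub : (Finset.univ.powersetCard r).filter
      (· ∈ (RGraph.circleGraph r (k - 1) x).edges) ⊆ (RGraph.circleGraph r (k - 1) x).edges :=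
    fun e he => (Finset.mem_filter.1 he).2
  refine le_trans ?_ (Nat.cast_le.2 (Finset.card_le_card hsub))
  rw [Finset.card_filter]
  push_cast
  refine Finset.sum_le_sum fun e _ => ?_
  by_cases h : e ∈ (RGraph.circleGraph r (k - 1) x).edges
  · rw [Set.indicator_of_mem (show x ∈ E e from h), if_pos h, Pi.one_apply]
  · rw [Set.indicator_of_notMem (show x ∉ E e from h), if_neg h]

theorem expectedShortestArc_le_turanDensity {r k : ℕ} (hk : 2 ≤ k) (hkr : k ≤ r + 1) :
    expectedShortestArc r (k - 1) ≤ RGraph.turanDensity (RGraph.kEdge r k) := by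
  have hne : (RGraph.kEdge r k).edges.Nonempty :=
    Finset.card_pos.1 (by rw [RGraph.card_kEdge hkr]; omega)
  refine ge_of_tendsto (RGraph.tendsto_turanDensity hne) ?_
  filter_upwards [eventually_ge_atTop r] with n hn
  rw [le_div_iff₀ (by exact_mod_cast Nat.choose_pos hn), mul_comm]
  exact choose_mul_expectedShortestArc_le_turanNumber hk hkr n

/-! ### Independence and the Chen–Stein estimate. -/

-- Each function factors through the restriction to its own coordinates; filling the missing ones
-- with `0` provides the factorisation.
open ProbabilityTheory in
theorem indepFun_of_dependsOn {ι β γ : Type*} [Fintype ι] [MeasurableSpace β] [MeasurableSpace γ]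
    {F : (ι → UnitAddCircle) → β} {G : (ι → UnitAddCircle) → γ} {S T : Finset ι}
    (hF : Measurable F) (hG : Measurable G) (hFS : DependsOn F S) (hGT : DependsOn G T)
    (hST : Disjoint S T) : IndepFun F G volume := by
  classical
  have hind : iIndepFun (fun (i : ι) (x : ι → UnitAddCircle) => x i) volume :=
    iIndepFun_pi (μ := fun _ : ι => (volume : Measure UnitAddCircle)) (X := fun _ => id)
      fun _ => aemeasurable_id
  have h := hind.indepFun_finset S T hST fun i => measurable_pi_apply i
  let ext (R : Finset ι) (y : R → UnitAddCircle) (j : ι) : UnitAddCircle :=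
    if hj : j ∈ R then y ⟨j, hj⟩ else 0
  have hext : ∀ R : Finset ι, Measurable (ext R) := fun R => measurable_pi_lambda _ fun j => by
    by_cases hj : j ∈ R
    · simpa [ext, hj] using measurable_pi_apply _
    · simp [ext, hj]
  have h2 := h.comp (hF.comp (hext S)) (hG.comp (hext T))
  convert h2 using 1
  · funext x
    exact hFS fun i hi => by simp [ext, Finset.mem_coe.1 hi]
  · funext x
    exact hGT fun i hi => by simp [ext, Finset.mem_coe.1 hi]

section ChenStein

theorem abs_pow_add_sub_pow_le {u : ℝ} (h0 : 0 ≤ u) (h1 : u ≤ 1) (a c : ℕ) :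
    |u ^ (a + c) - u ^ a| ≤ c := by
  rcases Nat.eq_zero_or_pos c with rfl | hc
  · simp
  · have h3 : (1 : ℝ) ≤ c := by exact_mod_cast hc
    have ha := pow_le_one₀ (n := a) h0 h1
    have hac := pow_le_one₀ (n := a + c) h0 h1
    have ha' := pow_nonneg h0 a
    have hac' := pow_nonneg h0 (a + c)
    rw [abs_le]
    constructor <;> linarith

variable {Ω α : Type*}

/-- The number of the events `E b`, `b ∈ B`, that occur. -/
noncomputable def eventCount (E : α → Set Ω) (B : Finset α) (ω : Ω) : ℕ :=
  ∑ b ∈ B, (E b).indicator 1 ω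

variable {E : α → Set Ω} {A : Finset α}

theorem eventCount_le_card (B : Finset α) (ω : Ω) : eventCount E B ω ≤ B.card := by
  unfold eventCount
  rw [Finset.card_eq_sum_ones]
  exact Finset.sum_le_sum fun b _ => Set.indicator_le_self' (fun _ _ => zero_le_one) ω

theorem eventCount_union [DecidableEq α] {B C : Finset α} (h : Disjoint B C) (ω : Ω) :
    eventCount E (B ∪ C) ω = eventCount E B ω + eventCount E C ω :=
  Finset.sum_union h

theorem cast_eventCount (B : Finset α) (ω : Ω) :
    (eventCount E B ω : ℝ) = ∑ b ∈ B, (E b).indicator (1 : Ω → ℝ) ω := by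
  unfold eventCount
  push_cast
  refine Finset.sum_congr rfl fun b _ => ?_
  by_cases h : ω ∈ E b <;> simp [h]

variable [MeasurableSpace Ω] {μ : Measure Ω} [IsProbabilityMeasure μ]

theorem measurable_eventCount (hE : ∀ a, MeasurableSet (E a)) (B : Finset α) :
    Measurable (eventCount E B) := by
  unfold eventCount
  exact Finset.measurable_fun_sum _ fun b _ => measurable_one.indicator (hE b)

theorem integrable_indicator_one_real (hE : ∀ a, MeasurableSet (E a)) (a : α) :
    Integrable ((E a).indicator (1 : Ω → ℝ)) μ :=
  (integrable_const (1 : ℝ)).indicator (hE a)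

theorem integral_eventCount (hE : ∀ a, MeasurableSet (E a)) (B : Finset α) :
    ∫ ω, (eventCount E B ω : ℝ) ∂μ = ∑ b ∈ B, μ.real (E b) := by
  simp only [cast_eventCount]
  rw [integral_finsetSum _ fun b _ => integrable_indicator_one_real hE b]
  exact Finset.sum_congr rfl fun b _ => integral_indicator_one (hE b)

theorem integrable_eventCount (hE : ∀ a, MeasurableSet (E a)) (B : Finset α) :
    Integrable (fun ω => (eventCount E B ω : ℝ)) μ := by
  simp only [cast_eventCount]
  exact integrable_finsetSum _ fun b _ => integrable_indicator_one_real hE b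

theorem integrable_pow_of_le_one {u : ℝ} (h0 : 0 ≤ u) (h1 : u ≤ 1) {f : Ω → ℕ}
    (hf : Measurable f) : Integrable (fun ω => u ^ f ω) μ := by
  refine Integrable.of_bound (measurable_from_nat.comp hf).aestronglyMeasurable 1
    (ae_of_all _ fun ω => ?_)
  rw [Real.norm_of_nonneg (pow_nonneg h0 _)]
  exact pow_le_one₀ h0 h1

theorem hasDerivAt_integral_pow {f : Ω → ℕ} (hf : Measurable f) {M : ℕ} (hM : ∀ ω, f ω ≤ M)
    (u : ℝ) :
    HasDerivAt (fun u : ℝ => ∫ ω, u ^ f ω ∂μ) (∫ ω, f ω * u ^ (f ω - 1) ∂μ) u := by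
  have hb : ∀ v : ℝ, ∀ n ≤ M, |v| ^ n ≤ (|v| + 1) ^ M := fun v n hn =>
    (pow_le_pow_left₀ (abs_nonneg v) (by linarith) n).trans
      (pow_le_pow_right₀ (by linarith [abs_nonneg v]) hn)
  have hmeas : ∀ v : ℝ, AEStronglyMeasurable (fun ω => v ^ f ω) μ := fun v =>
    (measurable_from_nat (f := fun n : ℕ => v ^ n) |>.comp hf).aestronglyMeasurable
  refine (hasDerivAt_integral_of_dominated_loc_of_deriv_le (F := fun (u : ℝ) ω => u ^ f ω)
    (F' := fun (u : ℝ) ω => f ω * u ^ (f ω - 1)) (s := Metric.ball u 1)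
    (bound := fun _ => M * (|u| + 1 + 1) ^ M)
    (Metric.ball_mem_nhds u one_pos) (Eventually.of_forall hmeas) ?_ ?_ ?_
    (integrable_const _) ?_).2
  · refine Integrable.of_bound (hmeas u) ((|u| + 1) ^ M) (ae_of_all _ fun ω => ?_)
    rw [norm_pow, Real.norm_eq_abs]
    exact hb u _ (hM ω)
  · exact (measurable_from_nat (f := fun n : ℕ => (n : ℝ) * u ^ (n - 1))
      |>.comp hf).aestronglyMeasurable
  · refine ae_of_all _ fun ω v hv => ?_
    have hv' : |v| ≤ |u| + 1 := by
      have := abs_sub_abs_le_abs_sub v u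
      rw [Metric.mem_ball, Real.dist_eq] at hv
      linarith
    rw [norm_mul, norm_pow, Real.norm_eq_abs, Real.norm_eq_abs, Nat.abs_cast]
    have h1 : (f ω : ℝ) ≤ M := by exact_mod_cast hM ω
    refine mul_le_mul h1 ((hb v _ ((Nat.sub_le _ _).trans (hM ω))).trans ?_) (by positivity)
      (by positivity)
    gcongr
  · exact ae_of_all _ fun ω v _ => hasDerivAt_pow (f ω) v

/-- The Chen–Stein bound for the probability that no event of a locally dependent family occurs. -/
theorem abs_real_forall_notMem_sub_exp_le [DecidableEq α] (hE : ∀ a, MeasurableSet (E a))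
    {N : α → Finset α} (hN : ∀ a ∈ A, N a ⊆ A) (hNa : ∀ a ∈ A, a ∈ N a)
    (hind : ∀ a ∈ A, ProbabilityTheory.IndepFun ((E a).indicator (1 : Ω → ℝ))
      (eventCount E (A \ N a)) μ) :
    |μ.real {ω | ∀ a ∈ A, ω ∉ E a} - Real.exp (-∑ a ∈ A, μ.real (E a))| ≤
      ∑ a ∈ A, (∑ b ∈ (N a).erase a, μ.real (E a ∩ E b) +
        ∑ b ∈ N a, μ.real (E a) * μ.real (E b)) := by
  set l := ∑ a ∈ A, μ.real (E a)
  set b := ∑ a ∈ A, (∑ b ∈ (N a).erase a, μ.real (E a ∩ E b) +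
        ∑ b ∈ N a, μ.real (E a) * μ.real (E b))
  have hl : 0 ≤ l := Finset.sum_nonneg fun _ _ => measureReal_nonneg
  let W := eventCount E A
  have hW : Measurable W := measurable_eventCount hE A
  let g : ℝ → ℝ := fun u => ∫ ω, u ^ W ω ∂μ
  let g' : ℝ → ℝ := fun u => ∫ ω, W ω * u ^ (W ω - 1) ∂μ
  have hg : ∀ u, HasDerivAt g (g' u) u := fun u =>
    hasDerivAt_integral_pow hW (fun ω => eventCount_le_card A ω) u
  -- The generating function of a Poisson variable of mean `l` satisfies `g' = l * g`. Here the
  -- defect is bounded event by event: drop the neighbours from the exponent on `E a` (`step1`), use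
  -- independence (`step2`), and put the neighbours back (`step3`).
  have hkey : ∀ u ∈ Set.Icc (0 : ℝ) 1, |g' u - l * g u| ≤ b := by
    rintro u ⟨h0, h1⟩
    have hint1 : ∀ a, Integrable (fun ω => (E a).indicator (1 : Ω → ℝ) ω * u ^ (W ω - 1)) μ :=
      fun a => (integrable_pow_of_le_one h0 h1
        (measurable_from_nat (f := fun n : ℕ => n - 1) |>.comp hW)).bdd_mul (c := 1)
        (measurable_one.indicator (hE a)).aestronglyMeasurable
        (ae_of_all _ fun ω => by by_cases h : ω ∈ E a <;> simp [h])
    have hg'sum : g' u = ∑ a ∈ A, ∫ ω, (E a).indicator (1 : Ω → ℝ) ω * u ^ (W ω - 1) ∂μ := by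
      rw [← integral_finsetSum _ fun a _ => hint1 a]
      simp only [g', W, cast_eventCount, Finset.sum_mul]
    rw [hg'sum, Finset.sum_mul, ← Finset.sum_sub_distrib]
    refine (Finset.abs_sum_le_sum_abs _ _).trans (Finset.sum_le_sum fun a ha => ?_)
    let V := eventCount E (A \ N a)
    have hV : Measurable V := measurable_eventCount hE _
    have hint2 : Integrable (fun ω => (E a).indicator (1 : Ω → ℝ) ω * u ^ V ω) μ :=
      (integrable_pow_of_le_one h0 h1 hV).bdd_mul (c := 1)
        (measurable_one.indicator (hE a)).aestronglyMeasurable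
        (ae_of_all _ fun ω => by by_cases h : ω ∈ E a <;> simp [h])
    have hWV : ∀ ω, W ω = V ω + eventCount E (N a) ω := fun ω => by
      rw [← eventCount_union Finset.sdiff_disjoint, Finset.sdiff_union_of_subset (hN a ha)]
    have hNe : ∀ ω, eventCount E (N a) ω =
        eventCount E ((N a).erase a) ω + (E a).indicator 1 ω := fun ω =>
      (Finset.sum_erase_add _ _ (hNa a ha)).symm
    have step1 : |∫ ω, (E a).indicator (1 : Ω → ℝ) ω * u ^ (W ω - 1) ∂μ -
        ∫ ω, (E a).indicator (1 : Ω → ℝ) ω * u ^ V ω ∂μ| ≤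
        ∑ b ∈ (N a).erase a, μ.real (E a ∩ E b) := by
      rw [← integral_sub (hint1 a) hint2, ← integral_eventCount (fun b => (hE a).inter (hE b))]
      refine abs_integral_le_integral_abs.trans (integral_mono ((hint1 a).sub hint2).abs
        (integrable_eventCount (fun b => (hE a).inter (hE b)) _) fun ω => ?_)
      by_cases h : ω ∈ E a
      · have h2 : eventCount (fun b => E a ∩ E b) ((N a).erase a) ω =
            eventCount E ((N a).erase a) ω :=
          Finset.sum_congr rfl fun b _ => by by_cases hb : ω ∈ E b <;> simp [h, hb]
        have h3 : W ω - 1 = V ω + eventCount E ((N a).erase a) ω := by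
          rw [hWV, hNe, Set.indicator_of_mem h, Pi.one_apply]
          omega
        simp only [h2, h3, Set.indicator_of_mem h, Pi.one_apply, one_mul]
        exact abs_pow_add_sub_pow_le h0 h1 _ _
      · simp [h]
    have step2 : ∫ ω, (E a).indicator (1 : Ω → ℝ) ω * u ^ V ω ∂μ =
        μ.real (E a) * ∫ ω, u ^ V ω ∂μ := by
      have h := ((hind a ha).comp measurable_id
        (measurable_from_nat (f := fun n : ℕ => u ^ n))).integral_fun_mul_eq_mul_integral
        (measurable_one.indicator (hE a)).aestronglyMeasurable
        (measurable_from_nat (f := fun n : ℕ => u ^ n) |>.comp hV).aestronglyMeasurable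
      rw [← integral_indicator_one (hE a)]
      exact h
    have step3 : |∫ ω, u ^ V ω ∂μ - g u| ≤ ∑ b ∈ N a, μ.real (E b) := by
      have hi1 := integrable_pow_of_le_one (μ := μ) h0 h1 hV
      have hi2 := integrable_pow_of_le_one (μ := μ) h0 h1 hW
      rw [← integral_sub hi1 hi2, ← integral_eventCount hE]
      refine abs_integral_le_integral_abs.trans (integral_mono (hi1.sub hi2).abs
        (integrable_eventCount hE _) fun ω => ?_)
      simp only [hWV]
      rw [abs_sub_comm]
      exact abs_pow_add_sub_pow_le h0 h1 _ _
    rw [step2] at step1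
    calc _ ≤ _ := abs_sub_le _ (μ.real (E a) * ∫ ω, u ^ V ω ∂μ) _
      _ ≤ _ := by
        refine add_le_add step1 ?_
        rw [← mul_sub, abs_mul, abs_of_nonneg measureReal_nonneg, ← Finset.mul_sum]
        exact mul_le_mul_of_nonneg_left step3 measureReal_nonneg
  -- The integrating factor turns the defect into a derivative. Comparing `u = 0`, where `g` is the
  -- sought probability, with `u = 1`, where `g = 1`, gives the bound.
  have hF : ∀ u ∈ Set.Icc (0 : ℝ) 1, HasDerivWithinAt (fun u => Real.exp (-(l * u)) * g u)
      (Real.exp (-(l * u)) * (g' u - l * g u)) (Set.Icc 0 1) u := by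
    intro u _
    have h1 : HasDerivAt (fun u : ℝ => Real.exp (-(l * u))) (Real.exp (-(l * u)) * -l) u := by
      simpa using (((hasDerivAt_id u).const_mul l).neg).exp
    exact ((h1.fun_mul (hg u)).congr_deriv (by ring)).hasDerivWithinAt
  have hbd : ∀ u ∈ Set.Icc (0 : ℝ) 1, ‖Real.exp (-(l * u)) * (g' u - l * g u)‖ ≤ b := by
    intro u hu
    rw [norm_mul, Real.norm_of_nonneg (Real.exp_pos _).le, Real.norm_eq_abs]
    have h1 : Real.exp (-(l * u)) ≤ 1 := Real.exp_le_one_iff.2 (by nlinarith [hu.1])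
    calc _ ≤ 1 * |g' u - l * g u| := mul_le_mul_of_nonneg_right h1 (abs_nonneg _)
      _ ≤ b := by rw [one_mul]; exact hkey u hu
  have hmv := (convex_Icc (0 : ℝ) 1).norm_image_sub_le_of_norm_hasDerivWithin_le hF hbd
    (Set.right_mem_Icc.2 zero_le_one) (Set.left_mem_Icc.2 zero_le_one)
  have hg1 : g 1 = 1 := by simp [g]
  have hg0 : g 0 = μ.real {ω | ∀ a ∈ A, ω ∉ E a} := by
    have hm : MeasurableSet {ω | ∀ a ∈ A, ω ∉ E a} := by
      simp only [Set.ofPred_forall]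
      exact MeasurableSet.biInter A.countable_toSet fun a _ => (hE a).compl
    rw [← integral_indicator_one hm]
    refine integral_congr_ae (ae_of_all _ fun ω => ?_)
    by_cases h : ∀ a ∈ A, ω ∉ E a
    · have : W ω = 0 := Finset.sum_eq_zero fun a ha => Set.indicator_of_notMem (h a ha) _
      simp only [this, pow_zero]
      rw [Set.indicator_of_mem (by exact h)]
      rfl
    · have : W ω ≠ 0 := by
        push Not at h
        obtain ⟨a, ha, hω⟩ := h
        intro h0
        have := Finset.sum_eq_zero_iff.1 h0 a ha
        simp [hω] at this
      simp only [zero_pow this]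
      rw [Set.indicator_of_notMem (by exact h)]
  simpa [hg1, hg0] using hmv

end ChenStein

/-! ### Marked sets and Poisson approximation for clusters. -/

/-- The `t`-subsets of `ι` with a marked element. -/
def markedSets (ι : Type*) [Fintype ι] [DecidableEq ι] (t : ℕ) : Finset (Finset ι × ι) :=
  (Finset.univ.powersetCard t ×ˢ Finset.univ).filter fun p => p.2 ∈ p.1

/-- All points of `p.1` are within the arc of length `L` that starts at the point `p.2`. -/
def arcEvent {ι : Type*} (L : ℝ) (p : Finset ι × ι) : Set (ι → UnitAddCircle) :=
  {x | ∀ j ∈ p.1, circRep (x j - x p.2) ≤ L}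

theorem measurableSet_arcEvent {ι : Type*} {L : ℝ} (p : Finset ι × ι) : MeasurableSet (arcEvent L p) := by
  simp only [arcEvent, Set.ofPred_forall]
  exact MeasurableSet.biInter p.1.countable_toSet fun j _ =>
    measurable_circRep_sub p.2 j measurableSet_Iic

section MarkedSets

variable {ι : Type*} [Fintype ι] [DecidableEq ι] {t : ℕ} {L : ℝ}

theorem mem_markedSets {p : Finset ι × ι} : p ∈ markedSets ι t ↔ p.1.card = t ∧ p.2 ∈ p.1 := by
  simp [markedSets]

theorem card_markedSets : (markedSets ι t).card = t * (Fintype.card ι).choose t := by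
  rw [markedSets, Finset.card_filter, Finset.sum_product]
  have : ∀ T ∈ (Finset.univ : Finset ι).powersetCard t,
      (∑ i : ι, if i ∈ T then 1 else 0) = t := fun T hT => by
    simpa using (Finset.mem_powersetCard.1 hT).2
  rw [Finset.sum_congr rfl this]
  simp [mul_comm]

theorem setOf_not_hasCluster_eq (ht : 0 < t) :
    {x : ι → UnitAddCircle | ¬ HasCluster t x L} =
      {x | ∀ p ∈ markedSets ι t, x ∉ arcEvent L p} := by
  ext x
  simp only [Set.mem_ofPred_eq, hasCluster_iff ht, mem_markedSets, arcEvent, Prod.forall]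
  constructor
  · rintro h T i ⟨hT, hi⟩ hx
    exact h ⟨T, hT, i, hi, hx⟩
  · rintro h ⟨T, hT, i, hi, hx⟩
    exact h T i ⟨hT, hi⟩ hx

theorem real_arcEvent {p : Finset ι × ι} (hp : p ∈ markedSets ι t) (h0 : 0 ≤ L) (h1 : L < 1) :
    volume.real (arcEvent L p) = L ^ (t - 1) := by
  rw [← (mem_markedSets.1 hp).1]
  exact real_volume_forall_circRep_sub_le (mem_markedSets.1 hp).2 h0 h1

theorem dependsOn_arcEvent {p : Finset ι × ι} (hp : p ∈ markedSets ι t) {β : Type*} [Zero β] (b : β) :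
    DependsOn ((arcEvent L p).indicator fun _ => b) (p.1 : Set ι) := by
  intro x y hxy
  refine Set.indicator_eq_indicator ?_ rfl
  have hi := hxy p.2 (mem_markedSets.1 hp).2
  simp only [arcEvent, Set.mem_ofPred_eq]
  refine forall₂_congr fun j hj => ?_
  rw [hxy j hj, hi]

end MarkedSets

/-- The two representatives add up to less than `1`, so their sum is the representative of `y + -y =
0`. -/
theorem eq_zero_of_circRep_le {y : UnitAddCircle} {L : ℝ} (hL : L < 1 / 2) (h1 : circRep y ≤ L)
    (h2 : circRep (-y) ≤ L) : y = 0 := by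
  have h := circRep_coe_of_mem (add_nonneg (circRep_nonneg y) (circRep_nonneg (-y)))
    (by linarith)
  rw [AddCircle.coe_add, coe_circRep, coe_circRep, add_neg_cancel, circRep_zero] at h
  have h3 : circRep y = 0 := by linarith [circRep_nonneg y, circRep_nonneg (-y)]
  rw [← coe_circRep y, h3, AddCircle.coe_zero]

theorem norm_le_circRep (y : UnitAddCircle) : ‖y‖ ≤ circRep y := by
  conv_lhs => rw [← coe_circRep y]
  exact (QuotientAddGroup.norm_mk_le_norm).trans_eq (Real.norm_of_nonneg (circRep_nonneg y))

section Pairs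

variable {ι : Type*} [Fintype ι] [DecidableEq ι] {t : ℕ} {L : ℝ}

/-- If both marked points come first in the same short arc, they coincide, which is a null event. So
different marks on one set cost nothing in the Chen–Stein error. -/
theorem real_arcEvent_inter_of_fst_eq {T : Finset ι} {i j : ι} (hi : i ∈ T) (hj : j ∈ T)
    (hij : i ≠ j) (hL : L < 1 / 2) :
    volume.real (arcEvent L (T, i) ∩ arcEvent L (T, j)) = 0 := by
  have h := volume_forall_sub_mem (i := i) (S := {j}) (by simpa using hij)
    (MeasurableSet.singleton (0 : UnitAddCircle))
  have h0 : volume ({0} : Set UnitAddCircle) = 0 := by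
    have := AddCircle.volume_closedBall (T := (1 : ℝ)) (x := 0) 0
    simpa using this
  rw [h0, Finset.card_singleton, pow_one] at h
  rw [Measure.real, measure_mono_null _ h, ENNReal.toReal_zero]
  rintro x ⟨hx, hy⟩ k hk
  obtain rfl := Finset.mem_singleton.1 hk
  refine eq_zero_of_circRep_le hL (hx k hj) ?_
  rw [neg_sub]
  exact hy i hi

/-- Through a common point `c`, every point of the union lies within `2 * L` of `x c`, in a ball of
measure at most `4 * L`. -/
theorem real_arcEvent_inter_le {T T' : Finset ι} {i j : ι} (hTT : ¬ Disjoint T' T)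
    (h0 : 0 ≤ L) :
    volume.real (arcEvent L (T, i) ∩ arcEvent L (T', j)) ≤ (4 * L) ^ ((T ∪ T').card - 1) := by
  obtain ⟨c, hc', hc⟩ := Finset.not_disjoint_iff.1 hTT
  have h := volume_forall_sub_mem (Finset.notMem_erase c (T ∪ T'))
    (B := Metric.closedBall (0 : UnitAddCircle) (2 * L)) measurableSet_closedBall
  rw [Finset.card_erase_of_mem (Finset.mem_union_left _ hc), AddCircle.volume_closedBall] at h
  have hdist : ∀ {x : ι → UnitAddCircle} {S : Finset ι} {i k : ι}, x ∈ arcEvent L (S, i) →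
      c ∈ S → k ∈ S → x k - x c ∈ Metric.closedBall (0 : UnitAddCircle) (2 * L) := by
    intro x S i k hx hc hk
    rw [mem_closedBall_zero_iff, ← sub_sub_sub_cancel_right (x k) (x c) (x i)]
    have h1 := (norm_le_circRep _).trans (hx k hk)
    have h2 := (norm_le_circRep _).trans (hx c hc)
    exact (norm_sub_le _ _).trans (by linarith)
  have hsub : arcEvent L (T, i) ∩ arcEvent L (T', j) ⊆
      {x | ∀ k ∈ (T ∪ T').erase c, x k - x c ∈ Metric.closedBall (0 : UnitAddCircle) (2 * L)} := by
    rintro x ⟨hx, hy⟩ k hk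
    rcases Finset.mem_union.1 (Finset.mem_of_mem_erase hk) with hk | hk
    · exact hdist hx hc hk
    · exact hdist hy hc' hk
  refine (measureReal_mono hsub).trans ?_
  rw [Measure.real, h, ENNReal.toReal_pow,
    ENNReal.toReal_ofReal (le_min zero_le_one (by linarith))]
  refine pow_le_pow_left₀ (le_min zero_le_one (by linarith)) ((min_le_right _ _).trans ?_) _
  linarith

/-- A bound for the weighted number of pairs of marked `t`-sets in terms of their unions. -/
def pairConst (t : ℕ) : ℕ := ∑ u ∈ Finset.range (2 * t + 1), (2 ^ u * u) ^ 2

/-- Group the pairs by their union: at most `r ^ u` sets have size `u`, which the weight cancels,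
and each arises from at most `(2 ^ u * u) ^ 2` pairs. -/
theorem sum_markedSets_inv_pow_le (ι : Type*) [Fintype ι] [DecidableEq ι] (t : ℕ) :
    ∑ p ∈ markedSets ι t ×ˢ markedSets ι t,
      ((Fintype.card ι : ℝ) ^ (p.1.1 ∪ p.2.1).card)⁻¹ ≤ pairConst t := by
  set r := Fintype.card ι
  have hmaps : ∀ p ∈ markedSets ι t ×ˢ markedSets ι t,
      p.1.1 ∪ p.2.1 ∈ (Finset.univ : Finset (Finset ι)).filter (·.card ∈ Finset.range (2 * t + 1)) := by
    rintro ⟨a, b⟩ h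
    obtain ⟨ha, hb⟩ := Finset.mem_product.1 h
    have h1 := (mem_markedSets.1 ha).1
    have h2 := (mem_markedSets.1 hb).1
    have := Finset.card_union_le a.1 b.1
    simp only [Finset.mem_filter, Finset.mem_univ, true_and, Finset.mem_range] at *
    omega
  rw [← Finset.sum_fiberwise_of_maps_to hmaps]
  have hfib : ∀ U : Finset ι, ∑ p ∈ markedSets ι t ×ˢ markedSets ι t with p.1.1 ∪ p.2.1 = U,
      ((r : ℝ) ^ (p.1.1 ∪ p.2.1).card)⁻¹ ≤ (2 ^ U.card * U.card) ^ 2 * ((r : ℝ) ^ U.card)⁻¹ := by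
    intro U
    have hc : ((markedSets ι t ×ˢ markedSets ι t).filter fun p => p.1.1 ∪ p.2.1 = U).card ≤
        (2 ^ U.card * U.card) ^ 2 := by
      have hsub : ((markedSets ι t ×ˢ markedSets ι t).filter fun p => p.1.1 ∪ p.2.1 = U) ⊆
          (U.powerset ×ˢ U) ×ˢ (U.powerset ×ˢ U) := by
        rintro ⟨a, b⟩ h
        obtain ⟨h', rfl⟩ := Finset.mem_filter.1 h
        obtain ⟨ha, hb⟩ := Finset.mem_product.1 h'
        simp only [Finset.mem_product, Finset.mem_powerset]
        exact ⟨⟨Finset.subset_union_left, Finset.mem_union_left _ (mem_markedSets.1 ha).2⟩,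
          ⟨Finset.subset_union_right, Finset.mem_union_right _ (mem_markedSets.1 hb).2⟩⟩
      refine (Finset.card_le_card hsub).trans_eq ?_
      simp [Finset.card_product, sq]
    rw [Finset.sum_congr (g := fun _ => ((r : ℝ) ^ U.card)⁻¹) rfl
      (fun p hp => by rw [(Finset.mem_filter.1 hp).2]), Finset.sum_const, nsmul_eq_mul]
    refine mul_le_mul_of_nonneg_right ?_ (by positivity)
    exact_mod_cast hc
  refine (Finset.sum_le_sum fun U _ => hfib U).trans ?_
  rw [← Finset.sum_fiberwise_of_maps_to (t := Finset.range (2 * t + 1)) (g := Finset.card)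
    (fun U hU => (Finset.mem_filter.1 hU).2), pairConst]
  push_cast
  refine Finset.sum_le_sum fun u hu => ?_
  rw [Finset.sum_congr (g := fun _ => (2 ^ u * u : ℝ) ^ 2 * ((r : ℝ) ^ u)⁻¹) rfl
    (fun p hp => by rw [(Finset.mem_filter.1 hp).2]), Finset.sum_const, nsmul_eq_mul]
  have hc : (((Finset.univ : Finset (Finset ι)).filter
      (·.card ∈ Finset.range (2 * t + 1))).filter (·.card = u)).card ≤ r ^ u := by
    refine le_trans (Finset.card_le_card (t := Finset.univ.powersetCard u) fun U hU => ?_) ?_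
    · exact Finset.mem_powersetCard.2 ⟨U.subset_univ, (Finset.mem_filter.1 hU).2⟩
    · rw [Finset.card_powersetCard, Finset.card_univ]
      exact Nat.choose_le_pow r u
  have hc' : ((((Finset.univ : Finset (Finset ι)).filter
      (·.card ∈ Finset.range (2 * t + 1))).filter (·.card = u)).card : ℝ) ≤ (r : ℝ) ^ u := by
    exact_mod_cast hc
  calc _ ≤ (r : ℝ) ^ u * ((2 ^ u * u : ℝ) ^ 2 * ((r : ℝ) ^ u)⁻¹) :=
        mul_le_mul_of_nonneg_right hc' (by positivity)
    _ = (2 ^ u * u : ℝ) ^ 2 * ((r : ℝ) ^ u * ((r : ℝ) ^ u)⁻¹) := by ring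
    _ ≤ (2 ^ u * u : ℝ) ^ 2 * 1 := mul_le_mul_of_nonneg_left mul_inv_le_one (by positivity)
    _ = _ := mul_one _

end Pairs

/-- Puts both kinds of Chen–Stein terms into the form of a common factor times the weight `(r ^
x)⁻¹`, with `x` the size of the union. -/
theorem four_mul_pow_le {r L : ℝ} {t m x : ℕ} (hr : 1 ≤ r) (h0 : 0 ≤ L) (h1 : 4 * L * r ≤ 1)
    (htm : t ≤ m) (hxm : x ≤ m + 1) :
    (4 * L) ^ m ≤ r * (4 * L * r) ^ t * (r ^ x)⁻¹ := by
  rw [← div_eq_mul_inv, le_div_iff₀ (by positivity)]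
  calc (4 * L) ^ m * r ^ x ≤ (4 * L) ^ m * r ^ (m + 1) := by gcongr
    _ = r * (4 * L * r) ^ m := by rw [mul_pow, pow_succ]; ring
    _ ≤ r * (4 * L * r) ^ t :=
      mul_le_mul_of_nonneg_left (pow_le_pow_of_le_one (by positivity) h1 htm) (by positivity)

theorem abs_real_not_hasCluster_sub_exp_le {r t : ℕ} (ht : 2 ≤ t) (hr : 1 ≤ r) {L : ℝ}
    (h0 : 0 ≤ L) (h1 : 4 * L * r ≤ 1) :
    |volume.real {x : Fin r → UnitAddCircle | ¬ HasCluster t x L} -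
        Real.exp (-(t * r.choose t * L ^ (t - 1)))| ≤
      2 * pairConst t * (r * (4 * L * r) ^ t) := by
  have hr' : (1 : ℝ) ≤ r := by exact_mod_cast hr
  have hL4 : 4 * L ≤ 1 := by nlinarith
  let A := markedSets (Fin r) t
  let N : Finset (Fin r) × Fin r → Finset (Finset (Fin r) × Fin r) := fun a =>
    A.filter fun b => ¬ Disjoint b.1 a.1
  have hdep : ∀ a ∈ A, ProbabilityTheory.IndepFun ((arcEvent L a).indicator
      (1 : (Fin r → UnitAddCircle) → ℝ)) (eventCount (arcEvent L) (A \ N a)) volume := by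
    intro a ha
    refine indepFun_of_dependsOn (S := a.1) (T := a.1ᶜ)
      (measurable_one.indicator (measurableSet_arcEvent a))
      (measurable_eventCount measurableSet_arcEvent _) (dependsOn_arcEvent ha 1) ?_
      disjoint_compl_right
    intro x y hxy
    refine Finset.sum_congr rfl fun b hb => ?_
    obtain ⟨hbA, hbN⟩ := Finset.mem_sdiff.1 hb
    have hd : Disjoint b.1 a.1 := by
      by_contra h
      exact hbN (Finset.mem_filter.2 ⟨hbA, h⟩)
    refine dependsOn_arcEvent hbA 1 fun i hi => hxy i ?_
    rw [Finset.mem_coe, Finset.mem_compl]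
    exact Finset.disjoint_left.1 hd hi
  have hCS := abs_real_forall_notMem_sub_exp_le (μ := volume) (E := arcEvent L) (A := A) (N := N)
    measurableSet_arcEvent (fun a _ => Finset.filter_subset _ _)
    (fun a ha => Finset.mem_filter.2 ⟨ha, by
      rw [disjoint_self, Finset.bot_eq_empty, ← ne_eq, ← Finset.nonempty_iff_ne_empty]
      exact ⟨_, (mem_markedSets.1 ha).2⟩⟩) hdep
  rw [← setOf_not_hasCluster_eq (by omega), Finset.sum_congr rfl fun a ha =>
    real_arcEvent (L := L) ha h0 (by linarith), Finset.sum_const, card_markedSets, nsmul_eq_mul,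
    Fintype.card_fin] at hCS
  push_cast at hCS
  refine hCS.trans ?_
  set c : ℝ := r * (4 * L * r) ^ t
  have hc : 0 ≤ c := by positivity
  let w : (Finset (Fin r) × Fin r) → (Finset (Fin r) × Fin r) → ℝ := fun a b =>
    ((r : ℝ) ^ (a.1 ∪ b.1).card)⁻¹
  have hw : ∀ a b, 0 ≤ w a b := fun a b => by positivity
  have hb2 : ∀ a ∈ A, ∀ b ∈ (N a).erase a,
      volume.real (arcEvent L a ∩ arcEvent L b) ≤ c * w a b := by
    rintro ⟨T, i⟩ ha ⟨T', j⟩ hb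
    obtain ⟨hne, hb⟩ := Finset.mem_erase.1 hb
    obtain ⟨hbA, hd⟩ := Finset.mem_filter.1 hb
    obtain ⟨hT, hi⟩ := mem_markedSets.1 ha
    obtain ⟨hT', hj⟩ := mem_markedSets.1 hbA
    simp only at hT hi hT' hj hd
    by_cases hTT : T = T'
    · subst hTT
      rw [real_arcEvent_inter_of_fst_eq hi hj (fun h => hne (by rw [h])) (by linarith)]
      exact mul_nonneg hc (hw _ _)
    · refine (real_arcEvent_inter_le hd h0).trans
        (four_mul_pow_le (x := (T ∪ T').card) hr' h0 h1 ?_ (by omega))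
      -- Distinct sets of equal size have a strictly larger union, so the exponent is at least `t`.
      have : T.card < (T ∪ T').card := by
        refine Finset.card_lt_card (Finset.subset_union_left.ssubset_of_ne fun h => hTT ?_)
        have hsub : T' ⊆ T := by rw [h]; exact Finset.subset_union_right
        exact (Finset.eq_of_subset_of_card_le hsub (by omega)).symm
      omega
  have hb1 : ∀ a ∈ A, ∀ b ∈ N a,
      volume.real (arcEvent L a) * volume.real (arcEvent L b) ≤ c * w a b := by
    intro a ha b hb
    obtain ⟨hbA, hd⟩ := Finset.mem_filter.1 hb
    -- The exponent `2 * (t - 1)` is at least `t` since `t ≥ 2`, and a common point makes the union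
    -- have at most `2 * t - 1` elements.
    rw [real_arcEvent ha h0 (by linarith), real_arcEvent hbA h0 (by linarith), ← pow_add]
    refine (pow_le_pow_left₀ h0 (by linarith : L ≤ 4 * L) _).trans
      (four_mul_pow_le hr' h0 h1 (by omega) ?_)
    have h2 := Finset.card_union_add_card_inter a.1 b.1
    have h3 : 0 < (a.1 ∩ b.1).card := by
      rw [Finset.card_pos, Finset.inter_comm]
      exact Finset.not_disjoint_iff_nonempty_inter.1 hd
    rw [(mem_markedSets.1 ha).1, (mem_markedSets.1 hbA).1] at h2
    omega
  have hN : ∀ a, ∑ b ∈ N a, c * w a b ≤ ∑ b ∈ A, c * w a b := fun a =>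
    Finset.sum_le_sum_of_subset_of_nonneg (Finset.filter_subset _ _)
      fun b _ _ => mul_nonneg hc (hw a b)
  have hN' : ∀ a, ∑ b ∈ (N a).erase a, c * w a b ≤ ∑ b ∈ A, c * w a b := fun a =>
    Finset.sum_le_sum_of_subset_of_nonneg ((Finset.erase_subset _ _).trans
      (Finset.filter_subset _ _)) fun b _ _ => mul_nonneg hc (hw a b)
  calc _ ≤ ∑ a ∈ A, (∑ b ∈ A, c * w a b + ∑ b ∈ A, c * w a b) :=
        Finset.sum_le_sum fun a ha => add_le_add
          ((Finset.sum_le_sum (hb2 a ha)).trans (hN' a))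
          ((Finset.sum_le_sum (hb1 a ha)).trans (hN a))
    _ = 2 * (∑ p ∈ A ×ˢ A, w p.1 p.2) * c := by
        rw [Finset.sum_add_distrib, ← two_mul, Finset.sum_product, mul_assoc, Finset.sum_mul]
        simp only [Finset.sum_mul, mul_comm c]
    _ ≤ 2 * pairConst t * c := by
        have := sum_markedSets_inv_pow_le (Fin r) t
        rw [Fintype.card_fin] at this
        gcongr

/-! ### Limit law and uniform tail of the rescaled shortest arc. -/

/-- The probability that no arc of length `L` contains `t` of `r` uniformly random points. -/
noncomputable def noClusterProb (t r : ℕ) (L : ℝ) : ℝ :=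
  volume.real {x : Fin r → UnitAddCircle | ¬ HasCluster t x L}

theorem noClusterProb_nonneg (t r : ℕ) (L : ℝ) : 0 ≤ noClusterProb t r L := measureReal_nonneg

theorem noClusterProb_le_one (t r : ℕ) (L : ℝ) : noClusterProb t r L ≤ 1 := measureReal_le_one

theorem antitone_noClusterProb (t r : ℕ) : Antitone (noClusterProb t r) := fun _ _ h =>
  measureReal_mono fun _ hx hc => hx (HasCluster.mono hc h)

theorem noClusterProb_eq_zero {t r : ℕ} (htr : t ≤ r) {L : ℝ} (hL : 1 ≤ L) :
    noClusterProb t r L = 0 := by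
  have : {x : Fin r → UnitAddCircle | ¬ HasCluster t x L} = ∅ :=
    Set.eq_empty_of_forall_notMem fun x hx => hx ((hasCluster_one x htr).mono hL)
  rw [noClusterProb, this, measureReal_empty]

/-- Two disjoint groups of points are independent, and both must be free of clusters. -/
theorem noClusterProb_add_le {t : ℕ} (ht : 0 < t) (a b : ℕ) (L : ℝ) :
    noClusterProb t (a + b) L ≤ noClusterProb t a L * noClusterProb t b L := by
  have : ((volume : Measure (Fin a → UnitAddCircle)).prod
      (volume : Measure (Fin b → UnitAddCircle))).IsAddHaarMeasure :=
    Measure.prod.instIsAddHaarMeasure _ _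
  have hmp : MeasurePreserving (fun x : Fin (a + b) → UnitAddCircle =>
      (x ∘ Fin.castAdd b, x ∘ Fin.natAdd a)) volume
      ((volume : Measure (Fin a → UnitAddCircle)).prod
        (volume : Measure (Fin b → UnitAddCircle))) :=
    measurePreserving_addMonoidHom_pi
      (f := { toFun := fun x : Fin (a + b) → UnitAddCircle => (x ∘ Fin.castAdd b, x ∘ Fin.natAdd a)
              map_zero' := rfl
              map_add' := fun _ _ => rfl })
      ((continuous_pi fun k => continuous_apply (Fin.castAdd b k)).prodMk
        (continuous_pi fun k => continuous_apply (Fin.natAdd a k)))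
      (fun y => ⟨Fin.append y.1 y.2, by
        ext i
        · simp
        · simp⟩)
  have hm : ∀ n, MeasurableSet {x : Fin n → UnitAddCircle | ¬ HasCluster t x L} := fun n =>
    (measurableSet_hasCluster ht measurable_const).compl
  have h := hmp.measureReal_preimage ((hm a).prod (hm b)).nullMeasurableSet
  rw [measureReal_prod_prod] at h
  unfold noClusterProb
  rw [← h]
  refine measureReal_mono fun x hx => ⟨fun hc => hx ?_, fun hc => hx ?_⟩
  · exact HasCluster.of_comp (Fin.castAdd_injective a b) hc
  · exact HasCluster.of_comp (Fin.natAdd_injective b a) hc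

theorem noClusterProb_le_pow {t : ℕ} (ht : 0 < t) (r a : ℕ) (L : ℝ) :
    noClusterProb t r L ≤ noClusterProb t a L ^ (r / a) := by
  have hpow : ∀ q, noClusterProb t (q * a) L ≤ noClusterProb t a L ^ q := by
    intro q
    induction q with
    | zero => simpa using noClusterProb_le_one t _ L
    | succ q ih =>
      rw [Nat.succ_mul, pow_succ]
      exact (noClusterProb_add_le ht _ _ L).trans
        (mul_le_mul_of_nonneg_right ih (noClusterProb_nonneg t a L))
  calc noClusterProb t r L = noClusterProb t (r / a * a + r % a) L := by
        rw [Nat.div_add_mod']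
    _ ≤ noClusterProb t (r / a * a) L * noClusterProb t (r % a) L := noClusterProb_add_le ht _ _ L
    _ ≤ noClusterProb t (r / a * a) L * 1 :=
      mul_le_mul_of_nonneg_left (noClusterProb_le_one t _ L) (noClusterProb_nonneg t _ L)
    _ ≤ _ := by rw [mul_one]; exact hpow _

theorem tendsto_choose_div_pow (m : ℕ) :
    Tendsto (fun r : ℕ => (r.choose m : ℝ) / (r : ℝ) ^ m) atTop (𝓝 (1 / (m ! : ℝ))) := by
  have h := (isEquivalent_choose m).div
    (Asymptotics.IsEquivalent.refl (u := fun r : ℕ => (r : ℝ) ^ m))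
  refine h.symm.tendsto_nhds (tendsto_const_nhds.congr' ?_)
  filter_upwards [eventually_ge_atTop 1] with r hr
  have : (0 : ℝ) < r := by exact_mod_cast hr
  simp only [Pi.div_apply]
  field_simp

theorem tendsto_noClusterProb {s : ℕ} (hs : 1 ≤ s) {z : ℝ} (hz : 0 ≤ z) :
    Tendsto (fun r : ℕ => noClusterProb (s + 1) r (z * (r : ℝ) ^ (-(1 + 1 / (s : ℝ))))) atTop
      (𝓝 (Real.exp (-(1 / (s ! : ℝ) * z ^ s)))) := by
  have hs0 : (s : ℝ) ≠ 0 := by positivity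
  let p : ℕ → ℝ := fun r => (r : ℝ) ^ (-(1 / (s : ℝ)))
  have hp : Tendsto p atTop (𝓝 0) :=
    (tendsto_rpow_neg_atTop (by positivity)).comp tendsto_natCast_atTop_atTop
  have hp0 : ∀ r, 0 ≤ p r := fun r => by positivity
  have hps : ∀ r : ℕ, p r ^ s = (r : ℝ)⁻¹ := fun r => by
    simp only [p]
    rw [← Real.rpow_natCast, ← Real.rpow_mul (by positivity)]
    rw [show -(1 / (s : ℝ)) * s = -1 by field_simp, Real.rpow_neg_one]
  have hL : ∀ r : ℕ, 1 ≤ r → (r : ℝ) ^ (-(1 + 1 / (s : ℝ))) = (r : ℝ)⁻¹ * p r := fun r hr => by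
    have : (0 : ℝ) < r := by exact_mod_cast hr
    rw [neg_add, Real.rpow_add this, Real.rpow_neg_one]
  have hlam : Tendsto (fun r : ℕ => Real.exp (-(((s + 1 : ℕ) : ℝ) *
      ((r.choose (s + 1) : ℝ) / (r : ℝ) ^ (s + 1)) * z ^ s))) atTop
      (𝓝 (Real.exp (-(1 / (s ! : ℝ) * z ^ s)))) := by
    refine (Real.continuous_exp.tendsto _).comp (Tendsto.neg (Tendsto.mul_const _ ?_))
    have h := (tendsto_choose_div_pow (s + 1)).const_mul ((s + 1 : ℕ) : ℝ)
    convert h using 2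
    rw [Nat.factorial_succ]
    push_cast
    field_simp
  have herr : Tendsto (fun r : ℕ => 2 * pairConst (s + 1) * ((4 * z) ^ (s + 1) * p r)) atTop
      (𝓝 0) := by
    simpa using (hp.const_mul ((4 * z) ^ (s + 1))).const_mul (2 * pairConst (s + 1) : ℝ)
  have hsmall : ∀ᶠ r : ℕ in atTop, 4 * z * p r ≤ 1 := by
    have : Tendsto (fun r => 4 * z * p r) atTop (𝓝 0) := by simpa using hp.const_mul (4 * z)
    exact (this.eventually_lt_const one_pos).mono fun _ h => h.le
  have hdiff : Tendsto (fun r : ℕ =>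
      noClusterProb (s + 1) r (z * (r : ℝ) ^ (-(1 + 1 / (s : ℝ)))) -
      Real.exp (-(((s + 1 : ℕ) : ℝ) *
      ((r.choose (s + 1) : ℝ) / (r : ℝ) ^ (s + 1)) * z ^ s))) atTop (𝓝 0) := by
    refine squeeze_zero_norm' ?_ herr
    filter_upwards [hsmall, eventually_ge_atTop 1] with r hr hr1
    have hr0 : (0 : ℝ) < r := by exact_mod_cast hr1
    have h4 : 4 * (z * ((r : ℝ)⁻¹ * p r)) * r = 4 * z * p r := by field_simp
    have h := abs_real_not_hasCluster_sub_exp_le (t := s + 1) (by omega) hr1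
      (L := z * ((r : ℝ)⁻¹ * p r)) (mul_nonneg hz (mul_nonneg (by positivity) (hp0 r)))
      (by rw [h4]; exact hr)
    rw [h4] at h
    rw [hL r hr1, Real.norm_eq_abs]
    have e1 : (z * ((r : ℝ)⁻¹ * p r)) ^ (s + 1 - 1) = z ^ s * ((r : ℝ) ^ (s + 1))⁻¹ := by
      rw [Nat.add_sub_cancel, mul_pow, mul_pow, hps, inv_pow, pow_succ, mul_inv]
    -- Of the `s + 1` factors `p r`, `s` cancel the factor `r`; the remaining one makes the error
    -- vanish.
    have e2 : (r : ℝ) * (4 * z * p r) ^ (s + 1) = (4 * z) ^ (s + 1) * p r := by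
      rw [mul_pow, pow_succ (p r), hps]
      field_simp
    rw [e1, e2] at h
    convert h using 4
    · rfl
    · ring
  simpa using hdiff.add hlam

theorem exists_noClusterProb_le_half {s : ℕ} (hs : 1 ≤ s) :
    ∃ z : ℝ, 0 < z ∧ ∃ a₀ : ℕ, 1 ≤ a₀ ∧ ∀ a, a₀ ≤ a →
      noClusterProb (s + 1) a (z * (a : ℝ) ^ (-(1 + 1 / (s : ℝ)))) ≤ 1 / 2 := by
  have hf : (1 : ℝ) ≤ (s ! : ℝ) := by exact_mod_cast Nat.factorial_pos s
  -- Any large `z` would serve; for `s !` the limiting exponent is at most `-1`.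
  have h := tendsto_noClusterProb hs (z := (s ! : ℝ)) (by positivity)
  have hlt : Real.exp (-(1 / (s ! : ℝ) * (s ! : ℝ) ^ s)) < 1 / 2 := by
    have h1 : (1 : ℝ) ≤ 1 / (s ! : ℝ) * (s ! : ℝ) ^ s := by
      rw [one_div, ← div_eq_inv_mul, le_div_iff₀ (by positivity), one_mul]
      exact le_self_pow₀ hf (by omega)
    calc Real.exp (-(1 / (s ! : ℝ) * (s ! : ℝ) ^ s)) ≤ Real.exp (-1) :=
          Real.exp_le_exp.2 (by linarith)
      _ < 1 / 2 := by linarith [Real.exp_neg_one_lt_half]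
  obtain ⟨a₀, ha₀⟩ := eventually_atTop.1 (h.eventually_lt_const hlt)
  exact ⟨(s ! : ℝ), by positivity, max a₀ 1, le_max_right _ _,
    fun a ha => (ha₀ a ((le_max_left _ _).trans ha)).le⟩

/-- A stretched exponential tail for the rescaled length of the shortest arc. -/
theorem exists_noClusterProb_le_exp {s : ℕ} (hs : 1 ≤ s) :
    ∃ c : ℝ, 0 < c ∧ ∀ r : ℕ, s + 1 ≤ r → ∀ z : ℝ, 0 < z →
      noClusterProb (s + 1) r (z * (r : ℝ) ^ (-(1 + 1 / (s : ℝ)))) ≤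
        2 * Real.exp (-c * z ^ (1 + 1 / (s : ℝ))⁻¹) := by
  obtain ⟨z₁, hz₁, a₀, ha₀, hhalf⟩ := exists_noClusterProb_le_half hs
  set β : ℝ := 1 + 1 / (s : ℝ)
  have hβ : 0 < β := by positivity
  set K : ℝ := a₀ + 1 + z₁ ^ β⁻¹
  have hK : 0 < K := by positivity
  refine ⟨Real.log 2 / K, by have := Real.log_pos one_lt_two; positivity, fun r hr z hz => ?_⟩
  have hr0 : (0 : ℝ) < r := by exact_mod_cast (by omega : 0 < r)
  set L : ℝ := z * (r : ℝ) ^ (-β)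
  have hL0 : 0 < L := by positivity
  rcases le_or_gt 1 L with hL1 | hL1
  · rw [noClusterProb_eq_zero hr hL1]
    positivity
  have hLr : z ^ β⁻¹ = r * L ^ β⁻¹ := by
    simp only [L]
    rw [Real.mul_rpow hz.le (by positivity), ← Real.rpow_mul hr0.le, neg_mul,
      mul_inv_cancel₀ hβ.ne', Real.rpow_neg_one]
    field_simp
  set w : ℝ := L ^ β⁻¹
  have hw0 : 0 < w := by positivity
  have hw1 : w ≤ 1 := Real.rpow_le_one hL0.le hL1.le (by positivity)
  -- The block size is just large enough that `z₁ * a ^ (-β) ≤ L`, so each block is free of clusters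
  -- with probability at most `1 / 2`. Since `a * w ≤ K`, there are at least about `z ^ β⁻¹ / K`
  -- blocks; the factor `2` in the bound pays for rounding down.
  set a : ℕ := max a₀ ⌈z₁ ^ β⁻¹ / w⌉₊
  have haa₀ : a₀ ≤ a := le_max_left _ _
  have ha1 : (1 : ℝ) ≤ a := by exact_mod_cast ha₀.trans haa₀
  have ha_ge : z₁ ^ β⁻¹ / w ≤ a :=
    (Nat.le_ceil _).trans (by exact_mod_cast le_max_right _ _)
  have ha_le : (a : ℝ) * w ≤ K := by
    have h1 : (a : ℝ) ≤ a₀ + (z₁ ^ β⁻¹ / w + 1) := by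
      have h2 : (a : ℝ) ≤ a₀ + (⌈z₁ ^ β⁻¹ / w⌉₊ : ℝ) := by
        exact_mod_cast max_le (by omega) (by omega)
      linarith [Nat.ceil_lt_add_one (show 0 ≤ z₁ ^ β⁻¹ / w by positivity)]
    calc (a : ℝ) * w ≤ (a₀ + (z₁ ^ β⁻¹ / w + 1)) * w := by gcongr
      _ = (a₀ + 1) * w + z₁ ^ β⁻¹ := by field_simp; ring
      _ ≤ (a₀ + 1) * 1 + z₁ ^ β⁻¹ := by gcongr
      _ = K := by simp only [K]; ring
  have hLa : z₁ * (a : ℝ) ^ (-β) ≤ L := by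
    have h1 : z₁ ^ β⁻¹ ≤ a * w := (div_le_iff₀ hw0).1 ha_ge
    have h2 := Real.rpow_le_rpow (by positivity) h1 hβ.le
    rw [Real.mul_rpow (by positivity) hw0.le, Real.rpow_inv_rpow hz₁.le hβ.ne',
      Real.rpow_inv_rpow hL0.le hβ.ne'] at h2
    rw [Real.rpow_neg (by positivity), ← div_eq_mul_inv, div_le_iff₀ (by positivity), mul_comm L]
    exact h2
  have hQ : noClusterProb (s + 1) a L ≤ 1 / 2 :=
    (antitone_noClusterProb _ _ hLa).trans (hhalf a haa₀)
  have hfloor : z ^ β⁻¹ / K - 1 ≤ ((r / a : ℕ) : ℝ) := by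
    have h1 : (r : ℝ) / a < ((r / a : ℕ) : ℝ) + 1 := by
      rw [← Nat.floor_div_eq_div (K := ℝ)]
      exact Nat.lt_floor_add_one _
    have h2 : z ^ β⁻¹ / K ≤ r / a := by
      rw [hLr, div_le_div_iff₀ hK (by positivity)]
      calc (r : ℝ) * w * a = r * (a * w) := by ring
        _ ≤ r * K := by gcongr
    linarith
  calc noClusterProb (s + 1) r L ≤ noClusterProb (s + 1) a L ^ (r / a) :=
        noClusterProb_le_pow s.succ_pos r a L
    _ ≤ (1 / 2) ^ (r / a) := pow_le_pow_left₀ (noClusterProb_nonneg _ _ _) hQ _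
    _ = Real.exp (-Real.log 2 * ((r / a : ℕ) : ℝ)) := by
        rw [mul_comm, Real.exp_nat_mul, Real.exp_neg, Real.exp_log two_pos, one_div]
    _ ≤ Real.exp (Real.log 2 + -(Real.log 2 / K) * z ^ β⁻¹) := by
        refine Real.exp_le_exp.2 ?_
        have := mul_le_mul_of_nonneg_left hfloor (Real.log_pos one_lt_two).le
        have e : Real.log 2 * (z ^ β⁻¹ / K - 1) = Real.log 2 / K * z ^ β⁻¹ - Real.log 2 := by ring
        linarith
    _ = 2 * Real.exp (-(Real.log 2 / K) * z ^ β⁻¹) := by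
        rw [Real.exp_add, Real.exp_log two_pos]

/-! ### Asymptotics of the mean and conclusion. -/

/-- The layer-cake formula, followed by a linear substitution. -/
theorem expectedShortestArc_mul_rpow {t r : ℕ} (ht : 0 < t) (htr : t ≤ r) (β : ℝ) :
    expectedShortestArc r t * (r : ℝ) ^ β =
      ∫ z in Set.Ioi (0 : ℝ), noClusterProb t r (z * (r : ℝ) ^ (-β)) := by
  have hr0 : (0 : ℝ) < r := by exact_mod_cast (by omega : 0 < r)
  rw [integral_comp_mul_right_Ioi (noClusterProb t r) 0 (by positivity), zero_mul,
    expectedShortestArc, (integrable_shortestArc ht htr).integral_eq_integral_meas_lt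
      (ae_of_all _ shortestArc_nonneg), Real.rpow_neg hr0.le, inv_inv, smul_eq_mul, mul_comm]
  simp only [noClusterProb, hasCluster_iff_shortestArc_le _ ht htr, not_le]

theorem arcConst_eq_integral {s : ℕ} (hs : 1 ≤ s) :
    ∫ z in Set.Ioi (0 : ℝ), Real.exp (-(1 / (s ! : ℝ) * z ^ s)) = arcConst (s + 2) := by
  have hs0 : (0 : ℝ) < s := by exact_mod_cast hs
  have hf : (0 : ℝ) < (s ! : ℝ) := by positivity
  have h := integral_exp_neg_mul_rpow hs0 (b := 1 / (s ! : ℝ)) (by positivity)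
  simp only [Real.rpow_natCast, neg_mul] at h
  rw [h, arcConst, show ((s + 2 : ℕ) : ℝ) - 2 = s by push_cast; ring, Nat.add_sub_cancel,
    add_comm (1 : ℝ), one_div, Real.inv_rpow hf.le, ← Real.rpow_neg hf.le]
  congr 2
  ring

theorem tendsto_expectedShortestArc_mul_rpow {s : ℕ} (hs : 1 ≤ s) :
    Tendsto (fun r : ℕ => expectedShortestArc r (s + 1) * (r : ℝ) ^ (1 + 1 / (s : ℝ))) atTop
      (𝓝 (arcConst (s + 2))) := by
  obtain ⟨c, hc, hbound⟩ := exists_noClusterProb_le_exp hs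
  have hγ : (0 : ℝ) < (1 + 1 / (s : ℝ))⁻¹ := by positivity
  rw [← arcConst_eq_integral hs]
  have hint : IntegrableOn (fun z : ℝ => 2 * Real.exp (-c * z ^ (1 + 1 / (s : ℝ))⁻¹))
      (Set.Ioi 0) := by
    refine Integrable.const_mul ?_ 2
    -- A non-integrable function has integral `0` by convention, whereas the Gamma formula gives a
    -- positive value.
    by_contra h
    have h1 := integral_exp_neg_mul_rpow hγ hc
    rw [integral_undef h] at h1
    have : 0 < Real.Gamma (1 / (1 + 1 / (s : ℝ))⁻¹ + 1) := Real.Gamma_pos_of_pos (by positivity)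
    have : 0 < c ^ (-1 / (1 + 1 / (s : ℝ))⁻¹) * Real.Gamma (1 / (1 + 1 / (s : ℝ))⁻¹ + 1) := by
      positivity
    exact this.ne h1
  have hlim := tendsto_integral_filter_of_dominated_convergence
    (μ := volume.restrict (Set.Ioi (0 : ℝ))) (l := atTop)
    (F := fun (r : ℕ) z => noClusterProb (s + 1) r (z * (r : ℝ) ^ (-(1 + 1 / (s : ℝ)))))
    (f := fun z => Real.exp (-(1 / (s ! : ℝ) * z ^ s))) _
    (Eventually.of_forall fun r =>
      ((antitone_noClusterProb (s + 1) r).measurable.comp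
        (measurable_id.mul_const _)).aestronglyMeasurable)
    (by
      filter_upwards [eventually_ge_atTop (s + 1)] with r hr
      refine (ae_restrict_iff' measurableSet_Ioi).2 (ae_of_all _ fun z hz => ?_)
      rw [Real.norm_of_nonneg (noClusterProb_nonneg _ _ _)]
      exact hbound r hr z hz)
    hint
    ((ae_restrict_iff' measurableSet_Ioi).2 (ae_of_all _ fun z hz =>
      tendsto_noClusterProb hs (le_of_lt hz)))
  refine hlim.congr' ?_
  filter_upwards [eventually_ge_atTop (s + 1)] with r hr
  exact (expectedShortestArc_mul_rpow s.succ_pos hr _).symm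

theorem mainTheorem3 (k : ℕ) (hk : 3 ≤ k) :
    -- for every `r`, the objects are well defined and `π(H_k^r) ≥ e_{r,k-1}`
    (∀ r : ℕ, k ≤ r + 1 →
      Tendsto (fun n : ℕ => (RGraph.turanNumber n (RGraph.kEdge r k) : ℝ) / (n.choose r : ℝ))
        atTop (𝓝 (RGraph.turanDensity (RGraph.kEdge r k))) ∧
      Integrable (fun x : Fin r → UnitAddCircle => shortestArc (k - 1) x) ∧
      expectedShortestArc r (k - 1) ≤ RGraph.turanDensity (RGraph.kEdge r k)) ∧
    -- `e_{r,k-1} = (C_k + o(1)) r^{-(1+1/(k-2))}`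
    (∃ ε : ℕ → ℝ, Tendsto ε atTop (𝓝 0) ∧ ∀ r : ℕ, k ≤ r + 1 →
      expectedShortestArc r (k - 1) =
        (arcConst k + ε r) * (r : ℝ) ^ (-(1 + 1 / ((k : ℝ) - 2)))) ∧
    -- `π(H_k^r) ≥ (C_k - o(1)) r^{-(1+1/(k-2))}`
    (∃ ε : ℕ → ℝ, Tendsto ε atTop (𝓝 0) ∧ ∀ r : ℕ, k ≤ r + 1 →
      (arcConst k - ε r) * (r : ℝ) ^ (-(1 + 1 / ((k : ℝ) - 2))) ≤
        RGraph.turanDensity (RGraph.kEdge r k)) := by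
  obtain ⟨s, rfl⟩ : ∃ s, k = s + 2 := ⟨k - 2, by omega⟩
  have hs : 1 ≤ s := by omega
  have hcast : ((s + 2 : ℕ) : ℝ) - 2 = s := by push_cast; ring
  have hsub : s + 2 - 1 = s + 1 := rfl
  have hlower : ∀ r : ℕ, s + 2 ≤ r + 1 →
      expectedShortestArc r (s + 1) ≤ RGraph.turanDensity (RGraph.kEdge r (s + 2)) :=
    fun r hr => expectedShortestArc_le_turanDensity (by omega) hr
  rw [hcast, hsub]
  have hε := (tendsto_expectedShortestArc_mul_rpow hs).sub_const (arcConst (s + 2))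
  rw [sub_self] at hε
  have hmul : ∀ r : ℕ, s + 2 ≤ r + 1 → expectedShortestArc r (s + 1) *
      (r : ℝ) ^ (1 + 1 / (s : ℝ)) * (r : ℝ) ^ (-(1 + 1 / (s : ℝ))) =
        expectedShortestArc r (s + 1) := fun r hr => by
    have hr0 : (0 : ℝ) < r := by exact_mod_cast (by omega : 0 < r)
    rw [mul_assoc, ← Real.rpow_add hr0, add_neg_cancel, Real.rpow_zero, mul_one]
  -- The error term is the rescaled mean minus `C_k`; its negative serves in the last claim.
  refine ⟨fun r hr => ⟨?_, integrable_shortestArc s.succ_pos (by omega), hlower r hr⟩,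
    ⟨_, hε, fun r hr => ?_⟩, ⟨_, by simpa only [neg_zero] using hε.neg, fun r hr => ?_⟩⟩
  · exact RGraph.tendsto_turanDensity
      (Finset.card_pos.1 (by rw [RGraph.card_kEdge hr]; omega))
  · rw [add_sub_cancel, hmul r hr]
  · refine le_trans (le_of_eq ?_) (hlower r hr)
    linear_combination hmul r hr
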